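/- Fix integers $k\ge 3$, $q\ge 3$ and a real $c>0$. Let $H=H_n$ be the random $k$-uniform multi-hypergraph on $[n]$ whose $\lfloor cn\rfloor$ edges are drawn independently and uniformly, with replacement, from all $k$-subsets of $[n]$. A $q$-colouring of $H$ is a map $\sigma:[n]\to[q]$ for which no edge is monochromatic. For $\omega=\omega(n)>0$, a map $\sigma:[n]\to[q]$ is $(\omega,n)$-balanced if $\bigl|\,|\sigma^{-1}(i)|/n-1/q\,\bigr|\le \omega^{-1}n^{-1/2}$ for all $i\in[q]$, and $Z_{q,\omega}(H)$ is the number of $(\omega,n)$-balanced $q$-colourings of $H$. A loose cycle of length $\ell\ge2$ in $H$ is a set of $\ell$ edges of $H$ (repeated edges being regarded as different) that can be labelled $e_a$, $a\in\mathbb Z/\ell$, so that there are distinct vertices $v_a$, $a\in\mathbb Z/\ell$, with $e_a\cap e_b=\{v_t : t\in\{a,a+1\}\cap\{b,b+1\}\}$ for all $a\neq b$. (So for $\ell\ge3$ consecutive edges share exactly one vertex, these $\ell$ shared vertices are distinct, and other pairs of edges are disjoint; for $\ell=2$ the two edges share exactly two vertices.) Let $C_\ell$ be the number of loose cycles of length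 $\ell$ in $H$, and for $\ell\ge 2$ put $$\lambda_\ell=\frac{[ck(k-1)]^\ell}{2\ell},\qquad \delta_\ell=\frac{(-1)^\ell(q-1)}{(q^{k-1}-1)^\ell}.$$ Let $\omega(n)>0$ be any sequence with $\omega(n)\to\infty$, let $L$ be a natural number and let $x_2,\dots,x_L$ be non-negative integers. Then: 1. As $n\to\infty$ through those $n$ for which an $(\omega,n)$-balanced map exists (all large $n$ if $\omega$ grows slowly, e.g. $\omega=o(\sqrt n)$), $$\frac{\mathbb E[Z_{q,\omega}(H)\mid C_\ell=x_\ell\ \ \forall\,2\le\ell\le L]}{\mathbb E[Z_{q,\omega}(H)]}\longrightarrow\prod_{\ell=2}^L(1+\delta_\ell)^{x_\ell}\exp(-\lambda_\ell\delta_\ell).$$ 2. Given a planted balanced colouring, the cycle counts are asymptotically independent Poisson variables with means $\mu_\ell=\lambda_\ell(1+\delta_\ell)$: as $n\to\infty$, uniformly over all $(\omega,n)$-balanced maps $\sigma$, $$\mathbb P\bigl[C_\ell=x_\ell\ \ \forall\,2\le\ell\le L\ \big|\ \sigma\text{ is a }q\text{-colouring of }H\bigr]\longrightarrow\prod_{\ell=2}^L\frac{e^{-\mu_\ell}\mu_\ell^{x_\ell}}{x_\ell!}.$$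 3. $\sum_{\ell\ge2}\lambda_\ell\delta_\ell^2<\infty$ if and only if $ck(k-1)<(q^{k-1}-1)^2$; in particular, the sum is finite whenever $c\le q^{k-1}\ln q$. -/

import Mathlib

open Filter Topology
open scoped BigOperators

namespace LooseCycles

/-- The sample space of the random `k`-uniform multi-hypergraph on `n` vertices with `m` edges:
the `m` edges are drawn from the `k`-subsets of the vertex set with replacement, so an outcome is
an arbitrary function from edge labels to `k`-subsets, and all outcomes are equally likely. -/
abbrev MultiHypergraph (n k m : ℕ) : Type :=
  Fin m → {e : Finset (Fin n) // e.card = k}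

open Classical in
/-- The expectation `E[X | S]` for a uniformly random multi-hypergraph `H`: the average of `X`
over the outcomes in the event `S` (with value `0` if no outcome lies in `S`). -/
noncomputable def condMean {n k m : ℕ} (X : MultiHypergraph n k m → ℝ)
    (S : MultiHypergraph n k m → Prop) : ℝ :=
  𝔼 H with S H, X H

/-- The (unconditional) expectation `E[X]` for a uniformly random multi-hypergraph. -/
noncomputable def mean {n k m : ℕ} (X : MultiHypergraph n k m → ℝ) : ℝ :=
  𝔼 H, X H

open Classical in
/-- The conditional probability `P[S | T]` for a uniformly random multi-hypergraph. -/
noncomputable def condProb {n k m : ℕ} (S T : MultiHypergraph n k m → Prop) : ℝ :=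
  condMean (fun H => if S H then 1 else 0) T

/-- `σ` is a `q`-colouring of `H`: every edge receives more than one colour. -/
def IsColouring {n k m q : ℕ} (H : MultiHypergraph n k m) (σ : Fin n → Fin q) : Prop :=
  ∀ j : Fin m, 1 < ((H j).1.image σ).card

/-- The colour density `n⁻¹ |σ⁻¹(i)|` of the colour `i`. -/
noncomputable def density {n q : ℕ} (σ : Fin n → Fin q) (i : Fin q) : ℝ :=
  ((Finset.univ.filter fun v => σ v = i).card : ℝ) / n

/-- `σ` is `(w, n)`-balanced: every colour density is within `w⁻¹ n^{-1/2}` of `1/q`. -/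
def IsBalanced {n q : ℕ} (w : ℝ) (σ : Fin n → Fin q) : Prop :=
  ∀ i : Fin q, |density σ i - 1 / q| ≤ 1 / (w * Real.sqrt n)

open Classical in
/-- The number of `(w, n)`-balanced `q`-colourings of `H`. -/
noncomputable def balancedCount {n k m : ℕ} (q : ℕ) (w : ℝ) (H : MultiHypergraph n k m) : ℕ :=
  (Finset.univ.filter fun σ : Fin n → Fin q => IsBalanced w σ ∧ IsColouring H σ).card

/-- A set `C` of (labelled) edges of `H` is a loose cycle of length `ℓ`: it consists of `ℓ` edges
that can be put in a cyclic order `e a`, `a ∈ ℤ/ℓ`, for which there are distinct vertices `v a`,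
`a ∈ ℤ/ℓ`, such that the edge at position `a` passes through `v a` and `v (a + 1)`, and two
different edges meet only in those vertices of the list that both of them pass through. So
consecutive edges share one vertex and other pairs are disjoint if `3 ≤ ℓ`, and the two edges of
a cycle of length `2` share exactly two vertices. -/
def IsLooseCycle {n k m : ℕ} (H : MultiHypergraph n k m) (ℓ : ℕ) (C : Finset (Fin m)) : Prop :=
  ∃ (e : ZMod ℓ → Fin m) (v : ZMod ℓ → Fin n),
    Function.Injective e ∧ Function.Injective v ∧ Set.range e = (C : Set (Fin m)) ∧
    ∀ a b : ZMod ℓ, a ≠ b →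
      ((H (e a)).1 : Set (Fin n)) ∩ ((H (e b)).1 : Set (Fin n)) =
        v '' (({a, a + 1} : Set (ZMod ℓ)) ∩ {b, b + 1})

open Classical in
/-- The number of loose cycles of length `ℓ` in `H`. -/
noncomputable def cycleCount {n k m : ℕ} (ℓ : ℕ) (H : MultiHypergraph n k m) : ℕ :=
  (Finset.univ.filter fun C : Finset (Fin m) => IsLooseCycle H ℓ C).card

/-- The event that the number of loose cycles of length `ℓ` is `x ℓ` for all `2 ≤ ℓ ≤ L`. -/
def CycleEvent {n k m : ℕ} (L : ℕ) (x : ℕ → ℕ) (H : MultiHypergraph n k m) : Prop :=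
  ∀ ℓ : ℕ, 2 ≤ ℓ → ℓ ≤ L → cycleCount ℓ H = x ℓ

/-- `λ_ℓ = [c k (k - 1)]^ℓ / (2 ℓ)`. -/
noncomputable def lam (k : ℕ) (c : ℝ) (ℓ : ℕ) : ℝ :=
  (c * k * ((k : ℝ) - 1)) ^ ℓ / (2 * ℓ)

/-- `δ_ℓ = (-1)^ℓ (q - 1) / (q^(k-1) - 1)^ℓ`. -/
noncomputable def del (k q : ℕ) (ℓ : ℕ) : ℝ :=
  (-1) ^ ℓ * ((q : ℝ) - 1) / ((q : ℝ) ^ (k - 1) - 1) ^ ℓ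

/-- The probability that a Poisson variable of mean `μ` takes the value `x`. -/
noncomputable def poissonProb (μ : ℝ) (x : ℕ) : ℝ :=
  Real.exp (-μ) * μ ^ x / (x.factorial : ℝ)

end LooseCycles

open Filter Topology
open scoped BigOperators

set_option linter.unusedSectionVars false

namespace LooseCycles

/-! Given that σ is a colouring, the edges are independent and uniform in the family 𝓕 of
non-monochromatic k-sets; without conditioning, 𝓕 consists of all k-sets. Both Poisson laws are
instances of one theorem on independent edges drawn from a family with |𝓕|/n^k → φ > 0
(`tendsto_pr_looseOn_counts`).

That theorem rests on a recursion in the spirit of Chen–Stein. Potential cycles on disjoint edge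
sets are independent, so x_j P[C = x] and E[C_j] P[C = x − e_j] differ by at most a sum over pairs
of potential cycles that share an edge (`abs_mul_pr_sub_le`). Two different cycles that share an
edge and have t edges together span fewer than (k−1)t vertices (`LooseOn.card_biUnion_union`), which
makes the error O(1/n) (`sum_pairs_le`). The recursion fixes the limit law up to normalisation, and
Markov's inequality supplies the normalisation (`tendsto_poisson_of_recursion`).

For the means, a loose cycle has 2ℓ cyclic orders, and to leading order the expected number of
orders is a sum over vertex sequences of products of codegrees in 𝓕. In the planted model a codegree
depends on whether the two vertices share a colour, so the sum becomes the trace of the ℓ-th power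
of a q×q matrix. Its eigenvalues are proportional to 1 − q^{-(k-1)}, once, and −q^{-(k-1)}, with
multiplicity q−1 (`sum_cyclic_potts`). The ℓ-th power of their ratio, times q−1, is δ_ℓ.

For the first moment, E[Z | E]/E[Z] is the average of P[E | σ] over balanced σ, weighted by P[σ is a
colouring], divided by P[E]. Since P[E | σ] converges uniformly in σ, the limit is a quotient of two
Poisson products. Finally λ_ℓ δ_ℓ² is a constant times r^ℓ/ℓ with r = ck(k−1)/(q^{k-1}−1)², which
settles the series. -/

open Classical in
/-- The probability of the event `S` under the uniform distribution on a finite type. -/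
noncomputable def pr {Ω : Type*} [Fintype Ω] (S : Ω → Prop) : ℝ :=
  ((Finset.univ.filter S).card : ℝ) / Fintype.card Ω

/-! ### Uniform probability on finite types -/

section Pr

variable {Ω : Type*} [Fintype Ω]

open Classical in
theorem pr_eq_sum (S : Ω → Prop) :
    pr S = (∑ ω : Ω, if S ω then (1 : ℝ) else 0) / Fintype.card Ω := by
  simp [pr, Finset.sum_boole]

theorem pr_eq_card (S : Ω → Prop) [DecidablePred S] :
    pr S = ((Finset.univ.filter S).card : ℝ) / Fintype.card Ω := by
  unfold pr
  congr!

theorem pr_nonneg (S : Ω → Prop) : 0 ≤ pr S := by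
  unfold pr; positivity

theorem pr_mono {S T : Ω → Prop} (h : ∀ ω, S ω → T ω) : pr S ≤ pr T := by
  classical
  unfold pr
  gcongr with ω hω
  exact h _

theorem pr_congr {S T : Ω → Prop} (h : ∀ ω, S ω ↔ T ω) : pr S = pr T := by
  rw [show S = T from funext fun ω => propext (h ω)]

theorem pr_true [Nonempty Ω] : pr (fun _ : Ω => True) = 1 := by
  classical
  have : (Fintype.card Ω : ℝ) ≠ 0 := by exact_mod_cast Fintype.card_ne_zero
  simp [pr, this]

theorem pr_or_le (S T : Ω → Prop) : pr (fun ω => S ω ∨ T ω) ≤ pr S + pr T := by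
  classical
  rw [pr_eq_card, pr_eq_card, pr_eq_card, ← add_div, Finset.filter_or]
  gcongr
  exact_mod_cast Finset.card_union_le _ _

theorem pr_exists_le_sum {β : Type*} (s : Finset β) (S : β → Ω → Prop) :
    pr (fun ω => ∃ b ∈ s, S b ω) ≤ ∑ b ∈ s, pr (S b) := by
  classical
  induction s using Finset.induction_on with
  | empty => simp [pr]
  | insert a s ha ih =>
    rw [Finset.sum_insert ha]
    refine (pr_mono (T := fun ω => S a ω ∨ ∃ b ∈ s, S b ω) ?_).trans
      ((pr_or_le _ _).trans (by gcongr))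
    intro ω
    simp

theorem abs_pr_sub_le {S T R : Ω → Prop} (h : ∀ ω, ¬ R ω → (S ω ↔ T ω)) :
    |pr S - pr T| ≤ pr R := by
  have h1 : pr S ≤ pr T + pr R := by
    refine (pr_mono fun ω hω => ?_).trans (pr_or_le T R)
    by_cases hR : R ω
    · exact Or.inr hR
    · exact Or.inl ((h ω hR).1 hω)
  have h2 : pr T ≤ pr S + pr R := by
    refine (pr_mono fun ω hω => ?_).trans (pr_or_le S R)
    by_cases hR : R ω
    · exact Or.inr hR
    · exact Or.inl ((h ω hR).2 hω)
  rw [abs_le]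
  constructor <;> linarith

open Classical in
theorem sum_pr_eq {β : Type*} (s : Finset β) (S : β → Ω → Prop) :
    ∑ b ∈ s, pr (S b) = (∑ ω : Ω, ((s.filter fun b => S b ω).card : ℝ)) / Fintype.card Ω := by
  simp_rw [pr_eq_sum]
  rw [← Finset.sum_div, Finset.sum_comm]
  simp [Finset.sum_boole]

/-- Every event that depends only on the coordinates in `A` is independent of every event that
depends only on the other coordinates. -/
theorem pr_and_of_disjoint {α X : Type*} [Fintype α] [DecidableEq α] [Fintype X]
    (A : Finset α) {S T : (α → X) → Prop}
    (hS : ∀ H H' : α → X, (∀ a ∈ A, H a = H' a) → (S H ↔ S H'))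
    (hT : ∀ H H' : α → X, (∀ a, a ∉ A → H a = H' a) → (T H ↔ T H')) :
    pr (fun H => S H ∧ T H) = pr S * pr T := by
  classical
  by_cases h0 : Fintype.card (α → X) = 0
  · simp [pr, h0]
  have key : ((Finset.univ.filter S).card * (Finset.univ.filter T).card : ℕ) =
      (Finset.univ.filter fun H => S H ∧ T H).card * Fintype.card (α → X) := by
    rw [← Finset.card_univ, ← Finset.card_product, ← Finset.card_product]
    -- Exchanging the coordinates outside `A` between two outcomes is an involution that carries S ×
    -- T onto (S ∧ T) × everything.
    let φ : (α → X) × (α → X) → (α → X) × (α → X) := fun p =>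
      (fun a => if a ∈ A then p.1 a else p.2 a, fun a => if a ∈ A then p.2 a else p.1 a)
    have hφ : ∀ p, φ (φ p) = p := by
      intro p
      ext a <;> by_cases ha : a ∈ A <;> simp [φ, ha]
    refine Finset.card_bij' (fun p _ => φ p) (fun p _ => φ p) ?_ ?_ (fun p _ => hφ p)
      (fun p _ => hφ p)
    · rintro ⟨H, H'⟩ h
      simp only [Finset.mem_product, Finset.mem_filter, Finset.mem_univ, true_and, and_true] at h ⊢
      refine ⟨(hS _ _ fun a ha => ?_).1 h.1, (hT _ _ fun a ha => ?_).1 h.2⟩ <;> simp [φ, ha]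
    · rintro ⟨H, H'⟩ h
      simp only [Finset.mem_product, Finset.mem_filter, Finset.mem_univ, true_and, and_true] at h ⊢
      refine ⟨(hS _ _ fun a ha => ?_).1 h.1, (hT _ _ fun a ha => ?_).1 h.2⟩ <;> simp [φ, ha]
  have h0' : (Fintype.card (α → X) : ℝ) ≠ 0 := by exact_mod_cast h0
  have key' : ((Finset.univ.filter S).card * (Finset.univ.filter T).card : ℝ) =
      (Finset.univ.filter fun H => S H ∧ T H).card * Fintype.card (α → X) := by
    exact_mod_cast key
  rw [pr_eq_card, pr_eq_card, pr_eq_card, div_mul_div_comm, key']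
  field_simp

theorem pr_forall_mem {α X : Type*} [Fintype α] [DecidableEq α] [Fintype X]
    (G : α → Finset X) :
    pr (fun H : α → X => ∀ a, H a ∈ G a) = ∏ a, (((G a).card : ℝ) / Fintype.card X) := by
  classical
  rw [pr_eq_card, show (Finset.univ.filter fun H : α → X => ∀ a, H a ∈ G a) = Fintype.piFinset G by
    ext H; simp [Fintype.mem_piFinset]]
  rw [Fintype.card_piFinset, Finset.prod_div_distrib, Fintype.card_fun]
  simp

/-- The coordinates are independent and uniform. -/
theorem pr_forall_mem_comp {α γ X : Type*} [Fintype α] [DecidableEq α] [Fintype γ] [Fintype X]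
    [Nonempty X] (e : γ → α) (he : Function.Injective e) (G : γ → Finset X) :
    pr (fun H : α → X => ∀ c, H (e c) ∈ G c) = ∏ c, (((G c).card : ℝ) / Fintype.card X) := by
  classical
  have hX : (Fintype.card X : ℝ) ≠ 0 := by exact_mod_cast Fintype.card_ne_zero
  -- Coordinates outside the range of `e` are constrained to all of `X`, which contributes factors
  -- 1.
  rw [Fintype.prod_of_injective e he _
    (fun a => (((Function.extend e G (fun _ => Finset.univ) a).card : ℝ) / Fintype.card X))]
  · rw [← pr_forall_mem]
    refine pr_congr fun H => ⟨fun h a => ?_, fun h c => ?_⟩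
    · by_cases ha : ∃ c, e c = a
      · obtain ⟨c, rfl⟩ := ha
        rw [he.extend_apply]
        exact h c
      · rw [Function.extend_apply' _ _ _ ha]
        simp
    · have := h (e c)
      rwa [he.extend_apply] at this
  · intro a ha
    rw [Function.extend_apply' _ _ _ (by simpa using ha)]
    simp [hX]
  · intro c
    rw [he.extend_apply]

end Pr

/-! ### The Poisson recursion for sums of locally dependent indicators -/

section Recursion

variable {Ω β J : Type*} [Fintype Ω] [Fintype β]

open Classical in
/-- The number of the indicators of kind `j`, among those in `s`, that are `1` at `ω`. -/
noncomputable def kindCount (κ : β → J) (I : β → Ω → Prop) (s : β → Prop) (j : J) (ω : Ω) : ℕ :=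
  (Finset.univ.filter fun b => κ b = j ∧ s b ∧ I b ω).card

/-- Multivariate Poisson recursion with the error bounded by the sum over neighbouring pairs. -/
theorem abs_mul_pr_sub_le (κ : β → J) (I : β → Ω → Prop) (nb : β → β → Prop)
    [DecidableEq β] [DecidableEq J] [∀ b, DecidablePred (nb b)]
    (hnb : ∀ b, nb b b)
    (hind : ∀ b (y : J → ℕ),
      pr (fun ω => I b ω ∧ ∀ j, kindCount κ I (fun b' => ¬ nb b b') j ω = y j) =
        pr (I b) * pr (fun ω => ∀ j, kindCount κ I (fun b' => ¬ nb b b') j ω = y j))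
    (x : J → ℕ) (j : J) (hx : 1 ≤ x j) :
    |(x j : ℝ) * pr (fun ω => ∀ i, kindCount κ I (fun _ => True) i ω = x i) -
      (∑ b with κ b = j, pr (I b)) *
        pr (fun ω => ∀ i, kindCount κ I (fun _ => True) i ω =
          Function.update x j (x j - 1) i)| ≤
      ∑ b, ∑ b' with nb b b',
        ((if b' = b then 0 else pr (fun ω => I b ω ∧ I b' ω)) + pr (I b) * pr (I b')) := by
  classical
  set y := Function.update x j (x j - 1) with hy
  set E : (J → ℕ) → Ω → Prop := fun x ω => ∀ i, kindCount κ I (fun _ => True) i ω = x i with hE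
  set D : β → Ω → Prop := fun b ω => ∀ i, kindCount κ I (fun b' => ¬ nb b b') i ω = y i with hD
  -- On the event `E x` exactly `x j` indicators of kind `j` equal 1.
  have h1 : (x j : ℝ) * pr (E x) = ∑ b with κ b = j, pr (fun ω => I b ω ∧ E x ω) := by
    rw [sum_pr_eq, pr_eq_sum, mul_div_assoc', Finset.mul_sum]
    congr 1
    refine Finset.sum_congr rfl fun ω _ => ?_
    by_cases h : E x ω
    · simp only [h, if_true, and_true, mul_one]
      rw [Finset.filter_filter]
      have := h j
      unfold kindCount at this
      simp only [true_and] at this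
      rw [this]
    · simp [h]
  -- If `b` occurs and no other neighbour of `b` does, the full counts are those outside the
  -- neighbourhood plus one in kind `j`, so `E x` and `D b` agree.
  have h2 : ∀ b, κ b = j → |pr (fun ω => I b ω ∧ E x ω) - pr (I b) * pr (D b)| ≤
      ∑ b' with nb b b', if b' = b then 0 else pr (fun ω => I b ω ∧ I b' ω) := by
    intro b hb
    rw [← hind]
    refine (abs_pr_sub_le (R := fun ω => ∃ b' ∈ (Finset.univ.filter (nb b)).erase b,
      I b ω ∧ I b' ω) ?_).trans ((pr_exists_le_sum _ _).trans ?_)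
    · intro ω hω
      refine and_congr_right fun hI => ?_
      have hcount : ∀ i, kindCount κ I (fun _ => True) i ω =
          kindCount κ I (fun b' => ¬ nb b b') i ω + if i = j then 1 else 0 := by
        intro i
        unfold kindCount
        have hno : ∀ b', nb b b' → I b' ω → b' = b := by
          intro b' h h'
          by_contra hne
          exact hω ⟨b', by simp [hne, h], hI, h'⟩
        by_cases hij : i = j
        · rw [if_pos hij, ← Finset.card_insert_of_notMem (a := b) (by simp [hnb])]
          congr 1
          ext b'
          simp only [Finset.mem_filter, Finset.mem_univ, true_and, Finset.mem_insert]
          constructor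
          · rintro ⟨h, h'⟩
            by_cases hn : nb b b'
            · exact Or.inl (hno _ hn h')
            · exact Or.inr ⟨h, hn, h'⟩
          · rintro (h | h)
            · subst h
              exact ⟨hb.trans hij.symm, hI⟩
            · exact ⟨h.1, h.2.2⟩
        · rw [if_neg hij, add_zero]
          congr 1
          ext b'
          simp only [Finset.mem_filter, Finset.mem_univ, true_and]
          constructor
          · rintro ⟨h, h'⟩
            refine ⟨h, fun hn => hij ?_, h'⟩
            have := hno _ hn h'
            subst this
            exact h.symm.trans hb
          · exact fun h => ⟨h.1, h.2.2⟩
      refine forall_congr' fun i => ?_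
      rw [hcount]
      by_cases hij : i = j
      · subst hij
        simp only [if_true, hy, Function.update_self]
        omega
      · simp [hy, hij]
    · rw [← Finset.sum_erase (Finset.univ.filter (nb b)) (a := b)
        (f := fun b' => if b' = b then 0 else pr (fun ω => I b ω ∧ I b' ω)) (by simp)]
      · refine le_of_eq (Finset.sum_congr rfl fun b' hb' => ?_)
        rw [if_neg (Finset.ne_of_mem_erase hb')]
  -- Restoring the neighbours changes the counts only if one of them occurs.
  have h3 : ∀ b, |pr (D b) - pr (E y)| ≤ ∑ b' with nb b b', pr (I b') := by
    intro b
    refine (abs_pr_sub_le (R := fun ω => ∃ b' ∈ Finset.univ.filter (nb b), I b' ω) ?_).trans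
      (pr_exists_le_sum _ _)
    intro ω hω
    refine forall_congr' fun i => ?_
    unfold kindCount
    refine Eq.congr_left (congrArg Finset.card (Finset.ext fun b' => ?_))
    simp only [Finset.mem_filter, Finset.mem_univ, true_and]
    refine and_congr_right fun _ => and_iff_right_of_imp fun h hn => hω ⟨b', by simp [hn], h⟩
  have h4 : ∀ b, 0 ≤ ∑ b' with nb b b',
      ((if b' = b then 0 else pr (fun ω => I b ω ∧ I b' ω)) + pr (I b) * pr (I b')) := by
    intro b
    refine Finset.sum_nonneg fun b' _ => ?_
    have := mul_nonneg (pr_nonneg (I b)) (pr_nonneg (I b'))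
    split_ifs
    · simpa using this
    · have := pr_nonneg (fun ω => I b ω ∧ I b' ω)
      positivity
  rw [h1, Finset.sum_mul, ← Finset.sum_sub_distrib]
  refine (Finset.abs_sum_le_sum_abs _ _).trans ?_
  refine le_trans ?_ (Finset.sum_le_sum_of_subset_of_nonneg
    (Finset.filter_subset (fun b => κ b = j) _) fun b _ _ => h4 b)
  refine Finset.sum_le_sum fun b hb => ?_
  rw [Finset.sum_add_distrib, ← Finset.mul_sum]
  have e2 := h2 b (by simpa using hb)
  have e3 := mul_le_mul_of_nonneg_left (h3 b) (pr_nonneg (I b))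
  rw [← abs_of_nonneg (pr_nonneg (I b)), ← abs_mul, abs_of_nonneg (pr_nonneg (I b))] at e3
  calc _ = |(pr (fun ω => I b ω ∧ E x ω) - pr (I b) * pr (D b)) +
      pr (I b) * (pr (D b) - pr (E y))| := by congr 1; ring
    _ ≤ _ := (abs_add_le _ _).trans (add_le_add e2 e3)

open Classical in
/-- Markov's inequality for the event that some count exceeds `K`. -/
theorem one_sub_le_sum_pr [Nonempty Ω] [Fintype J] [DecidableEq J] (κ : β → J)
    (I : β → Ω → Prop) (K : ℕ) :
    1 - (∑ b, pr (I b)) / (K + 1) ≤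
      ∑ x ∈ Fintype.piFinset (fun _ : J => Finset.range (K + 1)),
        pr (fun ω => ∀ i, kindCount κ I (fun _ => True) i ω = x i) := by
  set box := Fintype.piFinset (fun _ : J => Finset.range (K + 1))
  set C : Ω → J → ℕ := fun ω j => kindCount κ I (fun _ => True) j ω
  have h1 : (1 : ℝ) ≤ pr (fun ω => ∃ x ∈ box, ∀ i, C ω i = x i) + pr (fun ω => C ω ∉ box) := by
    rw [← pr_true (Ω := Ω)]
    refine (pr_mono fun ω _ => ?_).trans (pr_or_le _ _)
    by_cases h : C ω ∈ box
    · exact Or.inl ⟨C ω, h, fun _ => rfl⟩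
    · exact Or.inr h
  have h2 : pr (fun ω => C ω ∉ box) ≤ (∑ b, pr (I b)) / (K + 1) := by
    rw [le_div_iff₀ (by positivity), sum_pr_eq, pr_eq_sum, div_mul_eq_mul_div, Finset.sum_mul]
    gcongr with ω
    split_ifs with h
    · simp
    -- Outside the box one count, hence the total number of occurring indicators, is at least K + 1.
    · have : ∃ j, K + 1 ≤ C ω j := by
        by_contra! hcon
        exact h (Fintype.mem_piFinset.2 fun j => Finset.mem_range.2 (hcon j))
      obtain ⟨j, hj⟩ := this
      have hle : C ω j ≤ (Finset.univ.filter fun b => I b ω).card := by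
        refine Finset.card_le_card fun b hb => ?_
        simp only [Finset.mem_filter, Finset.mem_univ, true_and] at hb ⊢
        exact hb.2
      rw [one_mul]
      exact_mod_cast hj.trans hle
  have h3 := pr_exists_le_sum box (fun x ω => ∀ i, C ω i = x i)
  linarith

open Classical in
theorem sum_pr_count_le_one [Fintype J] [DecidableEq J] (C : Ω → J → ℕ)
    (s : Finset (J → ℕ)) : ∑ x ∈ s, pr (fun ω => ∀ i, C ω i = x i) ≤ 1 := by
  rw [sum_pr_eq]
  refine div_le_one_of_le₀ ?_ (by positivity)
  calc _ ≤ ∑ ω : Ω, (1 : ℝ) := by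
        refine Finset.sum_le_sum fun ω _ => ?_
        norm_cast
        refine Finset.card_le_one.2 fun a ha b hb => ?_
        simp only [Finset.mem_filter] at ha hb
        funext i
        rw [← ha.2, hb.2]
    _ = _ := by simp

end Recursion

/-! ### From the recursion to the Poisson limit -/

section Limit

variable {ι J : Type*} [Fintype J] [DecidableEq J] {l : Filter ι}
  {P : ι → (J → ℕ) → ℝ} {M : ι → J → ℝ} {μ : J → ℝ}

/-- Induction on the total Σ x_j: each use of the recursion removes one unit from some coordinate
and contributes μ_j/x_j. As P ≤ 1, replacing M by its limit costs o(1). -/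
theorem tendsto_sub_of_recursion
    (h0 : ∀ i x, 0 ≤ P i x) (h1 : ∀ i x, P i x ≤ 1)
    (hM : ∀ j, Tendsto (fun i => M i j) l (𝓝 (μ j)))
    (hrec : ∀ x j, 1 ≤ x j →
      Tendsto (fun i => x j * P i x - M i j * P i (Function.update x j (x j - 1))) l (𝓝 0))
    (x : J → ℕ) :
    Tendsto (fun i => P i x - P i 0 * ∏ j, μ j ^ x j / (x j).factorial) l (𝓝 0) := by
  induction hn : ∑ j, x j generalizing x with
  | zero =>
    have : x = 0 := by
      funext j
      simpa using (Finset.sum_eq_zero_iff.1 hn) j (Finset.mem_univ j)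
    subst this
    simpa using tendsto_const_nhds
  | succ n ih =>
    obtain ⟨j, hj⟩ : ∃ j, 1 ≤ x j := by
      by_contra! h
      rw [Finset.sum_eq_zero (fun j _ => by have := h j; omega)] at hn
      omega
    set y := Function.update x j (x j - 1) with hy
    have hsum : ∑ i, y i = n := by
      have e1 := Finset.add_sum_erase Finset.univ x (Finset.mem_univ j)
      have e2 := Finset.add_sum_erase Finset.univ y (Finset.mem_univ j)
      have e3 : ∑ i ∈ Finset.univ.erase j, y i = ∑ i ∈ Finset.univ.erase j, x i :=
        Finset.sum_congr rfl fun i hi => by simp [hy, Finset.ne_of_mem_erase hi]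
      have e4 : y j = x j - 1 := by simp [hy]
      omega
    have hprod : ∏ i, μ i ^ x i / ((x i).factorial : ℝ) =
        μ j / x j * ∏ i, μ i ^ y i / ((y i).factorial : ℝ) := by
      rw [← Finset.mul_prod_erase Finset.univ _ (Finset.mem_univ j),
        ← Finset.mul_prod_erase Finset.univ (fun i => μ i ^ y i / ((y i).factorial : ℝ))
          (Finset.mem_univ j), ← mul_assoc]
      congr 1
      · obtain ⟨r, hr⟩ : ∃ r, x j = r + 1 := ⟨x j - 1, by omega⟩
        have : y j = r := by simp [hy, hr]
        rw [this, hr, Nat.factorial_succ]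
        push_cast
        field_simp
        ring
      · exact Finset.prod_congr rfl fun i hi => by simp [hy, Finset.ne_of_mem_erase hi]
    have hx0 : (x j : ℝ) ≠ 0 := by
      have : x j ≠ 0 := by omega
      exact_mod_cast this
    have e1 := hrec x j hj
    have e2 : Tendsto (fun i => (M i j - μ j) * P i y) l (𝓝 0) := by
      have hz : Tendsto (fun i => M i j - μ j) l (𝓝 0) := by
        simpa using (hM j).sub_const (μ j)
      refine squeeze_zero_norm (fun i => ?_) (by simpa using hz.abs)
      rw [norm_mul, Real.norm_eq_abs, Real.norm_eq_abs, abs_of_nonneg (h0 i y)]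
      exact mul_le_of_le_one_right (abs_nonneg _) (h1 i y)
    have e3 := (ih y hsum).const_mul (μ j)
    have e4 := ((e1.add e2).add e3).div_const (x j : ℝ)
    simp only [mul_zero, add_zero, zero_div] at e4
    refine e4.congr fun i => ?_
    rw [hprod]
    field_simp
    ring

/-- A family of distributions on `J → ℕ` that satisfies the Poisson recursion asymptotically and
has controlled tails converges to the product of Poisson distributions. -/
theorem tendsto_poisson_of_recursion
    (h0 : ∀ i x, 0 ≤ P i x)
    (hle : ∀ i (s : Finset (J → ℕ)), ∑ x ∈ s, P i x ≤ 1)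
    (htail : ∀ᶠ i in l, ∀ K : ℕ, 1 - (∑ j, M i j) / (K + 1) ≤
      ∑ x ∈ Fintype.piFinset (fun _ : J => Finset.range (K + 1)), P i x)
    (hM : ∀ j, Tendsto (fun i => M i j) l (𝓝 (μ j)))
    (hrec : ∀ x j, 1 ≤ x j →
      Tendsto (fun i => x j * P i x - M i j * P i (Function.update x j (x j - 1))) l (𝓝 0))
    (x : J → ℕ) :
    Tendsto (fun i => P i x) l (𝓝 (∏ j, poissonProb (μ j) (x j))) := by
  have h1 : ∀ i x, P i x ≤ 1 := fun i x => by simpa using hle i {x}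
  have hsub := tendsto_sub_of_recursion h0 h1 hM hrec
  set S : ℝ := ∏ j, Real.exp (μ j) with hS
  set T : ℕ → ℝ := fun K => ∏ j, ∑ r ∈ Finset.range (K + 1), μ j ^ r / (r.factorial : ℝ) with hT
  have hTS : Tendsto T atTop (𝓝 S) := by
    refine tendsto_finsetProd _ fun j _ => ?_
    have := (NormedSpace.expSeries_div_hasSum_exp (μ j)).tendsto_sum_nat
    rw [← Real.exp_eq_exp_ℝ] at this
    exact this.comp (tendsto_add_atTop_nat 1)
  -- Over a box the sum of the products μ^x/x! factors into truncated exponential series.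
  have hbox : ∀ K, Tendsto (fun i => (∑ x ∈ Fintype.piFinset (fun _ : J => Finset.range (K + 1)),
      P i x) - P i 0 * T K) l (𝓝 0) := by
    intro K
    have := tendsto_finsetSum (Fintype.piFinset (fun _ : J => Finset.range (K + 1)))
      fun x _ => hsub x
    simp only [Finset.sum_const_zero] at this
    refine this.congr fun i => ?_
    rw [Finset.sum_sub_distrib, ← Finset.mul_sum, hT]
    simp only
    rw [Finset.prod_univ_sum]
  have hMs : Tendsto (fun i => ∑ j, M i j) l (𝓝 (∑ j, μ j)) :=
    tendsto_finsetSum _ fun j _ => hM j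
  -- Normalisation: a large box carries mass between 1 − O(1/K) and 1, and this mass is
  -- asymptotically P(0) T_K with T_K close to S. The bound Σ μ_j + 1 holds eventually for the total
  -- mean, so K can be fixed before i.
  have hzero : Tendsto (fun i => P i 0 * S) l (𝓝 1) := by
    rw [Metric.tendsto_nhds]
    intro ε hε
    have hKlim : Tendsto (fun K : ℕ => |S - T K| + (∑ j, μ j + 1) / ((K : ℝ) + 1)) atTop (𝓝 0) := by
      have a1 : Tendsto (fun K : ℕ => |S - T K|) atTop (𝓝 0) := by
        simpa using (hTS.const_sub S).abs
      have a2 : Tendsto (fun K : ℕ => (∑ j, μ j + 1) / ((K : ℝ) + 1)) atTop (𝓝 0) :=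
        tendsto_const_nhds.div_atTop
          (tendsto_natCast_atTop_atTop.atTop_add tendsto_const_nhds)
      simpa using a1.add a2
    obtain ⟨K, hK⟩ := (hKlim.eventually_lt_const (half_pos hε)).exists
    filter_upwards [htail, (hbox K).abs.eventually_lt_const (u := ε / 2) (by simpa using hε),
      hMs.eventually_lt_const (lt_add_one _)] with i hi i2 i3
    have i1 := hi K
    have i4 := hle i (Fintype.piFinset (fun _ : J => Finset.range (K + 1)))
    have i5 : |P i 0 * (S - T K)| ≤ |S - T K| := by
      rw [abs_mul, abs_of_nonneg (h0 i 0)]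
      exact mul_le_of_le_one_left (abs_nonneg _) (h1 i 0)
    have i6 : (∑ j, M i j) / ((K : ℝ) + 1) ≤ (∑ j, μ j + 1) / ((K : ℝ) + 1) := by
      gcongr
    rw [Real.dist_eq, abs_lt]
    rw [abs_le] at i5
    rw [abs_lt] at i2
    constructor <;> linarith
  have hS0 : S ≠ 0 := Finset.prod_ne_zero_iff.2 fun j _ => (Real.exp_pos _).ne'
  have hzero' : Tendsto (fun i => P i 0) l (𝓝 S⁻¹) := by
    have := hzero.mul_const S⁻¹
    simpa [mul_assoc, hS0] using this
  have := (hsub x).add (hzero'.mul_const (∏ j, μ j ^ x j / ((x j).factorial : ℝ)))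
  simp only [sub_add_cancel, zero_add] at this
  convert this using 2
  rw [hS, ← Finset.prod_inv_distrib, ← Finset.prod_mul_distrib]
  refine Finset.prod_congr rfl fun j _ => ?_
  rw [poissonProb, Real.exp_neg, mul_div_assoc]

end Limit

/-! ### Combinatorics of loose cycles -/

section Cycles

variable {α V : Type*} {ℓ : ℕ}

/-- `e` lists edges of `G` and `v` vertices in the cyclic order of a loose cycle. -/
def IsCycleOrder (G : α → Finset V) (e : ZMod ℓ → α) (v : ZMod ℓ → V) : Prop :=
  Function.Injective e ∧ Function.Injective v ∧ ∀ a b : ZMod ℓ, a ≠ b → ∀ x,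
    (x ∈ G (e a) ∧ x ∈ G (e b)) ↔ ∃ t, (t = a ∨ t = a + 1) ∧ (t = b ∨ t = b + 1) ∧ v t = x

theorem isLooseCycle_iff {n k m : ℕ} (H : MultiHypergraph n k m) (ℓ : ℕ) (C : Finset (Fin m)) :
    IsLooseCycle H ℓ C ↔ ∃ (e : ZMod ℓ → Fin m) (v : ZMod ℓ → Fin n),
      IsCycleOrder (fun j => (H j).1) e v ∧ Set.range e = (C : Set (Fin m)) := by
  unfold IsLooseCycle IsCycleOrder
  refine exists_congr fun e => exists_congr fun v => ?_
  have : ∀ a b : ZMod ℓ, (((H (e a)).1 : Set (Fin n)) ∩ ((H (e b)).1 : Set (Fin n)) =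
      v '' (({a, a + 1} : Set (ZMod ℓ)) ∩ {b, b + 1})) ↔ ∀ x,
      (x ∈ (H (e a)).1 ∧ x ∈ (H (e b)).1) ↔
        ∃ t, (t = a ∨ t = a + 1) ∧ (t = b ∨ t = b + 1) ∧ v t = x := by
    intro a b
    rw [Set.ext_iff]
    simp [and_assoc]
  simp only [this]
  tauto

namespace IsCycleOrder

variable [Fact (1 < ℓ)] {G : α → Finset V} {e : ZMod ℓ → α} {v : ZMod ℓ → V}

theorem mem_and (h : IsCycleOrder G e v) (a : ZMod ℓ) :
    v (a + 1) ∈ G (e a) ∧ v (a + 1) ∈ G (e (a + 1)) :=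
  (h.2.2 a (a + 1) (by simp) _).2 ⟨a + 1, by simp, by simp, rfl⟩

theorem mem_right (h : IsCycleOrder G e v) (a : ZMod ℓ) : v (a + 1) ∈ G (e a) :=
  (h.mem_and a).1

theorem mem_left (h : IsCycleOrder G e v) (a : ZMod ℓ) : v a ∈ G (e a) := by
  simpa using (h.mem_and (a - 1)).2

theorem eq_or_eq_of_mem (h : IsCycleOrder G e v) {t b : ZMod ℓ} (ht : v t ∈ G (e b)) :
    t = b ∨ t = b + 1 := by
  by_cases htb : t = b
  · exact Or.inl htb
  · obtain ⟨s, -, hs, hst⟩ := (h.2.2 t b htb _).1 ⟨h.mem_left t, ht⟩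
    rw [← h.2.1 hst]
    exact hs

/-- A common vertex is some `v t`; once the initial vertices are deleted, t must be both a + 1 and b
+ 1. These disjoint sets of size k − 1 are the basis of all vertex counts below. -/
theorem disjoint_erase [DecidableEq V] (h : IsCycleOrder G e v) {a b : ZMod ℓ} (hab : a ≠ b) :
    Disjoint ((G (e a)).erase (v a)) ((G (e b)).erase (v b)) := by
  rw [Finset.disjoint_left]
  intro x hx hx'
  rw [Finset.mem_erase] at hx hx'
  obtain ⟨t, h1, h2, rfl⟩ := (h.2.2 a b hab x).1 ⟨hx.2, hx'.2⟩
  have h1 := h1.resolve_left fun h => hx.1 (by rw [h])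
  have h2 := h2.resolve_left fun h => hx'.1 (by rw [h])
  exact hab (add_right_cancel (h1.symm.trans h2))

theorem card_biUnion_erase [DecidableEq V] {k : ℕ} (h : IsCycleOrder G e v)
    (hk : ∀ j, (G j).card = k) (T : Finset (ZMod ℓ)) :
    (T.biUnion fun a => (G (e a)).erase (v a)).card = (k - 1) * T.card := by
  rw [Finset.card_biUnion fun a _ b _ hab => h.disjoint_erase hab,
    Finset.sum_congr rfl fun a _ => Finset.card_erase_of_mem (h.mem_left a)]
  simp [hk, mul_comm]

/-- A proper set of positions has an arc beginning at some a with a − 1 missing. The vertex `v a`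
lies only in the edges a − 1 and a, so it is not covered by the sets with initial vertices deleted
and counts in addition. -/
theorem card_biUnion_lower [NeZero ℓ] [DecidableEq V] {k : ℕ} (h : IsCycleOrder G e v)
    (hk : ∀ j, (G j).card = k) {T : Finset (ZMod ℓ)} (hT : T.Nonempty) (hT' : T ≠ Finset.univ) :
    (k - 1) * T.card + 1 ≤ (T.biUnion fun a => G (e a)).card := by
  obtain ⟨a, ha, ha'⟩ : ∃ a ∈ T, a - 1 ∉ T := by
    by_contra! hcon
    obtain ⟨a, ha⟩ := hT
    refine hT' (Finset.eq_univ_iff_forall.2 fun b => ?_)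
    -- If no arc begins anywhere, stepping backwards from one element of T reaches every position.
    have key : ∀ r : ℕ, a - r ∈ T := by
      intro r
      induction r with
      | zero => simpa using ha
      | succ r ih =>
        have := hcon _ ih
        rwa [sub_sub, ← Nat.cast_succ] at this
    have := key (a - b).val
    rwa [ZMod.natCast_zmod_val, sub_sub_cancel] at this
  rw [← h.card_biUnion_erase hk, ← Finset.card_insert_of_notMem (a := v a)]
  · refine Finset.card_le_card (Finset.insert_subset ?_ ?_)
    · exact Finset.mem_biUnion.2 ⟨a, ha, h.mem_left a⟩
    · exact Finset.biUnion_mono fun b _ => Finset.erase_subset _ _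
  · rw [Finset.mem_biUnion]
    rintro ⟨b, hb, hab⟩
    rw [Finset.mem_erase] at hab
    rcases h.eq_or_eq_of_mem hab.2 with rfl | rfl
    · exact hab.1 rfl
    · exact ha' (by simpa using hb)

/-- Around the full cycle nothing is lost by deleting initial vertices: `v a` is still present as
the final vertex of the preceding edge. -/
theorem card_biUnion_upper [NeZero ℓ] [DecidableEq V] {k : ℕ} (h : IsCycleOrder G e v)
    (hk : ∀ j, (G j).card = k) :
    (Finset.univ.biUnion fun a => G (e a)).card ≤ (k - 1) * ℓ := by
  have h1 := h.card_biUnion_erase hk Finset.univ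
  rw [Finset.card_univ, ZMod.card] at h1
  rw [← h1]
  refine Finset.card_le_card fun x hx => ?_
  rw [Finset.mem_biUnion] at hx ⊢
  obtain ⟨a, -, ha⟩ := hx
  by_cases hxa : x = v a
  · refine ⟨a - 1, Finset.mem_univ _, Finset.mem_erase.2 ⟨?_, ?_⟩⟩
    · rw [hxa]
      exact fun hc => by simpa using (h.2.1 hc).symm
    · rw [hxa]
      simpa using h.mem_right (a - 1)
  · exact ⟨a, Finset.mem_univ _, Finset.mem_erase.2 ⟨hxa, ha⟩⟩

theorem shift (h : IsCycleOrder G e v) (a : ZMod ℓ) :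
    IsCycleOrder G (fun b => e (a + b)) (fun b => v (a + b)) := by
  refine ⟨h.1.comp (add_right_injective a), h.2.1.comp (add_right_injective a), ?_⟩
  intro b c hbc x
  rw [h.2.2 (a + b) (a + c) (by simpa using hbc)]
  constructor
  · rintro ⟨t, h1, h2, rfl⟩
    refine ⟨t - a, ?_, ?_, by simp⟩
    · rcases h1 with rfl | rfl
      · left; ring
      · right; ring
    · rcases h2 with rfl | rfl
      · left; ring
      · right; ring
  · rintro ⟨t, h1, h2, rfl⟩
    refine ⟨a + t, ?_, ?_, rfl⟩
    · rcases h1 with rfl | rfl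
      · left; ring
      · right; ring
    · rcases h2 with rfl | rfl
      · left; ring
      · right; ring

/-- Reversal exchanges the two end vertices of every edge, hence the offset 1 between the vertex and
edge indices. -/
theorem reflect (h : IsCycleOrder G e v) (a : ZMod ℓ) :
    IsCycleOrder G (fun b => e (a - b)) (fun b => v (a + 1 - b)) := by
  refine ⟨h.1.comp (sub_right_injective), h.2.1.comp (sub_right_injective), ?_⟩
  intro b c hbc x
  rw [h.2.2 (a - b) (a - c) (by simpa using hbc)]
  constructor
  · rintro ⟨t, h1, h2, rfl⟩
    refine ⟨a + 1 - t, ?_, ?_, by simp⟩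
    · rcases h1 with rfl | rfl
      · right; ring
      · left; ring
    · rcases h2 with rfl | rfl
      · right; ring
      · left; ring
  · rintro ⟨t, h1, h2, rfl⟩
    refine ⟨a + 1 - t, ?_, ?_, rfl⟩
    · rcases h1 with rfl | rfl
      · right; ring
      · left; ring
    · rcases h2 with rfl | rfl
      · right; ring
      · left; ring

/-- A cyclic order of a loose cycle is determined by its first edge and its first vertex. -/
theorem unique [NeZero ℓ] {e' : ZMod ℓ → α} {v' : ZMod ℓ → V} (h : IsCycleOrder G e v)
    (h' : IsCycleOrder G e' v') (hr : Set.range e' = Set.range e) (he : e' 0 = e 0)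
    (hv : v' 0 = v 0) : e' = e ∧ v' = v := by
  -- The next vertex of the second order lies in edge r and in another edge b of the cycle, so it is
  -- v r or v (r + 1). Injectivity of v' excludes v r, and v (r + 1) lies in no edge but r and r +
  -- 1, so b = r + 1.
  have key : ∀ r : ℕ, e' r = e r ∧ v' r = v r := by
    intro r
    induction r with
    | zero => simpa using ⟨he, hv⟩
    | succ r ih =>
      obtain ⟨ih1, ih2⟩ := ih
      have hmem := h'.mem_and (r : ZMod ℓ)
      obtain ⟨b, hb⟩ : e' ((r : ZMod ℓ) + 1) ∈ Set.range e := hr ▸ Set.mem_range_self _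
      have hbr : (r : ZMod ℓ) ≠ b := by
        intro hc
        have := h'.1 (hb.symm.trans ((congrArg e hc.symm).trans ih1.symm))
        simp at this
      rw [← hb, ih1] at hmem
      obtain ⟨t, ht1, ht2, ht3⟩ := (h.2.2 _ _ hbr _).1 hmem
      have ht : t = (r : ZMod ℓ) + 1 := by
        refine ht1.resolve_left fun hc => ?_
        rw [hc, ← ih2] at ht3
        have := h'.2.1 ht3
        simp at this
      subst ht
      push_cast
      refine ⟨?_, ht3.symm⟩
      rw [← hb]
      rcases ht2 with hc | hc
      · rw [hc]
      · exact absurd (add_right_cancel hc) hbr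
  have hcast : ∀ a : ZMod ℓ, ((a.val : ℕ) : ZMod ℓ) = a := ZMod.natCast_zmod_val
  constructor
  · funext a
    rw [← hcast a]
    exact (key _).1
  · funext a
    rw [← hcast a]
    exact (key _).2

open Classical in
/-- A loose cycle of length `ℓ` has exactly `2 ℓ` cyclic orders. -/
theorem card_orders [NeZero ℓ] [Fintype α] [Fintype V] (h : IsCycleOrder G e v) :
    (Finset.univ.filter fun p : (ZMod ℓ → α) × (ZMod ℓ → V) =>
      IsCycleOrder G p.1 p.2 ∧ Set.range p.1 = Set.range e).card = 2 * ℓ := by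
  -- The orders are the dihedral images of the given one. The edge at 0 determines the shift, and
  -- the vertex at 0 determines the orientation.
  let Φ : ZMod ℓ × Bool → (ZMod ℓ → α) × (ZMod ℓ → V) := fun p =>
    if p.2 then (fun b => e (p.1 - b), fun b => v (p.1 + 1 - b))
    else (fun b => e (p.1 + b), fun b => v (p.1 + b))
  have hΦ : Function.Injective Φ := by
    rintro ⟨a, s⟩ ⟨b, t⟩ hab
    have h1 : e a = e b := by
      have := congrFun (congrArg Prod.fst hab) 0
      cases s <;> cases t <;> simpa [Φ] using this
    obtain rfl := h.1 h1
    have h2 := congrFun (congrArg Prod.snd hab) 0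
    cases s <;> cases t <;> simp [Φ, h.2.1.eq_iff] at h2 ⊢
  have himage : (Finset.univ.filter fun p : (ZMod ℓ → α) × (ZMod ℓ → V) =>
      IsCycleOrder G p.1 p.2 ∧ Set.range p.1 = Set.range e) = Finset.univ.image Φ := by
    ext ⟨e', v'⟩
    simp only [Finset.mem_filter, Finset.mem_univ, true_and, Finset.mem_image]
    constructor
    · rintro ⟨h', hr⟩
      obtain ⟨a, ha⟩ : e' 0 ∈ Set.range e := hr ▸ Set.mem_range_self _
      -- The vertex at 0 is shared with the edge at −1, so it is one of the two end vertices `v a`,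
      -- `v (a + 1)` of the first edge: this decides between shift and reflection.
      obtain ⟨b, hb⟩ : e' (-1) ∈ Set.range e := hr ▸ Set.mem_range_self _
      have hm := h'.mem_and (-1)
      rw [neg_add_cancel, ← ha, ← hb] at hm
      have hba : b ≠ a := by
        intro hc
        have := h'.1 (hb.symm.trans ((congrArg e hc).trans ha))
        simp at this
      obtain ⟨t, -, ht, htv⟩ := (h.2.2 b a hba _).1 hm
      rcases ht with rfl | rfl
      · refine ⟨(t, false), ?_⟩
        obtain ⟨h1, h2⟩ := (h.shift t).unique h' (by
          rw [hr]
          exact ((Equiv.addLeft t).surjective.range_comp e).symm) (by simp [ha]) (by simp [htv])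
        simp [Φ, h1, h2]
      · refine ⟨(a, true), ?_⟩
        obtain ⟨h1, h2⟩ := (h.reflect a).unique h' (by
          rw [hr]
          exact ((Equiv.subLeft a).surjective.range_comp e).symm) (by simp [ha]) (by simp [htv])
        simp [Φ, h1, h2]
    · rintro ⟨⟨a, s⟩, hs⟩
      cases s
      · simp only [Φ, Prod.mk.injEq, Bool.false_eq_true, if_false] at hs
        obtain ⟨rfl, rfl⟩ := hs
        exact ⟨h.shift a, (Equiv.addLeft a).surjective.range_comp e⟩
      · simp only [Φ, Prod.mk.injEq, if_true] at hs
        obtain ⟨rfl, rfl⟩ := hs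
        exact ⟨h.reflect a, (Equiv.subLeft a).surjective.range_comp e⟩
  rw [himage, Finset.card_image_of_injective _ hΦ]
  simp [ZMod.card, mul_comm]

end IsCycleOrder

/-- A cyclic sequence of edges through given vertices that has further intersections spans few
vertices. -/
theorem card_biUnion_of_not_isCycleOrder [NeZero ℓ] [Fact (1 < ℓ)] [DecidableEq V]
    {G : α → Finset V} {e : ZMod ℓ → α} {v : ZMod ℓ → V} {k : ℕ} (hk : ∀ j, (G j).card = k)
    (he : Function.Injective e) (hv : Function.Injective v)
    (hl : ∀ a, v a ∈ G (e a)) (hr : ∀ a, v (a + 1) ∈ G (e a)) (h : ¬ IsCycleOrder G e v) :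
    (Finset.univ.biUnion fun a => G (e a)).card + 1 ≤ (k - 1) * ℓ := by
  -- If the edges without their initial vertices were pairwise disjoint, the only intersections
  -- would be the prescribed ones and the order would be that of a loose cycle.
  obtain ⟨a, b, hab, x, hxa, hxb⟩ : ∃ a b : ZMod ℓ, a ≠ b ∧
      ∃ x, x ∈ (G (e a)).erase (v a) ∧ x ∈ (G (e b)).erase (v b) := by
    by_contra! hcon
    refine h ⟨he, hv, fun a b hab x => ⟨fun hx => ?_, ?_⟩⟩
    · have hprev : ∀ c, v c ∈ (G (e (c - 1))).erase (v (c - 1)) := fun c => by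
        rw [Finset.mem_erase]
        refine ⟨fun hc => by simpa using (hv hc).symm, by simpa using hr (c - 1)⟩
      by_cases hxa : x = v a
      · subst hxa
        refine ⟨a, Or.inl rfl, ?_, rfl⟩
        by_contra! hc
        refine hcon b (a - 1) (fun hc' => hc.2 (by rw [hc']; ring)) (v a) ?_ (hprev a)
        exact Finset.mem_erase.2 ⟨fun hc' => hc.1 (hv hc'), hx.2⟩
      · by_cases hxb : x = v b
        · subst hxb
          refine ⟨b, ?_, Or.inl rfl, rfl⟩
          by_contra! hc
          refine hcon a (b - 1) (fun hc' => hc.2 (by rw [hc']; ring)) (v b) ?_ (hprev b)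
          exact Finset.mem_erase.2 ⟨fun hc' => hc.1 (hv hc'), hx.1⟩
        · exact absurd (Finset.mem_erase.2 ⟨hxb, hx.2⟩)
            (hcon a b hab x (Finset.mem_erase.2 ⟨hxa, hx.1⟩))
    · rintro ⟨t, h1, h2, rfl⟩
      constructor
      · rcases h1 with rfl | rfl
        · exact hl _
        · exact hr _
      · rcases h2 with rfl | rfl
        · exact hl _
        · exact hr _
  set D : ZMod ℓ → Finset V := fun c => (G (e c)).erase (v c) with hD
  have hcard : ∀ c, (D c).card = k - 1 := fun c => by
    rw [hD]
    simp only
    rw [Finset.card_erase_of_mem (hl c), hk]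
  -- These sets of size k − 1 cover everything, and `x` may be dropped from one of them because
  -- another still contains it: this saves one vertex.
  have hsub : (Finset.univ.biUnion fun a => G (e a)) ⊆
      Finset.univ.biUnion (Function.update D a ((D a).erase x)) := by
    have hcov : ∀ y c, y ∈ D c → y ∈ Finset.univ.biUnion (Function.update D a ((D a).erase x)) := by
      intro y c hy
      rw [Finset.mem_biUnion]
      by_cases hca : c = a
      · subst hca
        by_cases hyx : y = x
        · subst hyx
          exact ⟨b, Finset.mem_univ _, by rw [Function.update_of_ne hab.symm]; exact hxb⟩
        · exact ⟨c, Finset.mem_univ _, by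
            rw [Function.update_self]; exact Finset.mem_erase.2 ⟨hyx, hy⟩⟩
      · exact ⟨c, Finset.mem_univ _, by rwa [Function.update_of_ne hca]⟩
    intro y hy
    rw [Finset.mem_biUnion] at hy
    obtain ⟨c, -, hc⟩ := hy
    by_cases hyc : y = v c
    · refine hcov y (c - 1) (Finset.mem_erase.2 ⟨?_, ?_⟩)
      · rw [hyc]
        exact fun hc' => by simpa using (hv hc').symm
      · rw [hyc]
        simpa using hr (c - 1)
    · exact hcov y c (Finset.mem_erase.2 ⟨hyc, hc⟩)
  have h1 := (Finset.card_le_card hsub).trans Finset.card_biUnion_le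
  rw [← Finset.add_sum_erase _ _ (Finset.mem_univ a), Function.update_self,
    Finset.card_erase_of_mem hxa, hcard] at h1
  have h2 : ∑ c ∈ Finset.univ.erase a, (Function.update D a ((D a).erase x) c).card =
      (ℓ - 1) * (k - 1) := by
    rw [Finset.sum_congr rfl fun c hc => by
      rw [Function.update_of_ne (Finset.ne_of_mem_erase hc), hcard]]
    simp [ZMod.card]
  rw [h2] at h1
  have hk1 : 1 ≤ k - 1 := by
    rw [← hcard a]
    exact Finset.card_pos.2 ⟨x, hxa⟩
  obtain ⟨r, rfl⟩ : ∃ r, ℓ = r + 1 := ⟨ℓ - 1, by have := NeZero.pos ℓ; omega⟩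
  obtain ⟨s, hs⟩ : ∃ s, k - 1 = s + 1 := ⟨k - 2, by omega⟩
  rw [hs] at h1 ⊢
  simp only [Nat.add_sub_cancel] at h1
  nlinarith

/-- `C` is the set of the edges of a loose cycle of length `ℓ`. -/
def LooseOn (G : α → Finset V) (ℓ : ℕ) (C : Finset α) : Prop :=
  ∃ (e : ZMod ℓ → α) (v : ZMod ℓ → V), IsCycleOrder G e v ∧ Set.range e = (C : Set α)

namespace LooseOn

variable {G : α → Finset V} {C : Finset α} {k : ℕ}

theorem card_eq [NeZero ℓ] (h : LooseOn G ℓ C) : C.card = ℓ := by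
  classical
  obtain ⟨e, v, h, hr⟩ := h
  have : C = Finset.univ.image e := by
    apply Finset.coe_injective
    simp [hr]
  rw [this, Finset.card_image_of_injective _ h.1, Finset.card_univ, ZMod.card]

theorem congr {G' : α → Finset V} (hG : ∀ a ∈ C, G a = G' a) :
    LooseOn G ℓ C → LooseOn G' ℓ C := by
  rintro ⟨e, v, ⟨h1, h2, h3⟩, hr⟩
  refine ⟨e, v, ⟨h1, h2, fun a b hab x => ?_⟩, hr⟩
  have hmem : ∀ c, e c ∈ C := fun c => by
    rw [← Finset.mem_coe, ← hr]
    exact Set.mem_range_self c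
  rw [← hG _ (hmem a), ← hG _ (hmem b)]
  exact h3 a b hab x

variable [DecidableEq V]

theorem card_biUnion_upper [NeZero ℓ] [Fact (1 < ℓ)] (h : LooseOn G ℓ C)
    (hk : ∀ j, (G j).card = k) : (C.biUnion G).card ≤ (k - 1) * C.card := by
  classical
  rw [h.card_eq]
  obtain ⟨e, v, h, hr⟩ := h
  have : C = Finset.univ.image e := by
    apply Finset.coe_injective
    simp [hr]
  rw [this, Finset.image_biUnion]
  exact h.card_biUnion_upper hk

theorem card_biUnion_lower [NeZero ℓ] [Fact (1 < ℓ)] (h : LooseOn G ℓ C)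
    (hk : ∀ j, (G j).card = k) {S : Finset α} (hS : S.Nonempty) (hSC : S ⊂ C) :
    (k - 1) * S.card + 1 ≤ (S.biUnion G).card := by
  classical
  obtain ⟨e, v, h, hr⟩ := h
  have hC : C = Finset.univ.image e := by
    apply Finset.coe_injective
    simp [hr]
  have hST : S = (Finset.univ.filter fun a => e a ∈ S).image e := by
    ext x
    simp only [Finset.mem_image, Finset.mem_filter, Finset.mem_univ, true_and]
    constructor
    · intro hx
      have := hSC.1 hx
      rw [hC, Finset.mem_image] at this
      obtain ⟨a, -, rfl⟩ := this
      exact ⟨a, hx, rfl⟩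
    · rintro ⟨a, ha, rfl⟩
      exact ha
  set T := Finset.univ.filter fun a => e a ∈ S
  rw [hST, Finset.card_image_of_injective _ h.1, Finset.image_biUnion]
  refine h.card_biUnion_lower hk ?_ ?_
  · rw [hST] at hS
    exact Finset.image_nonempty.1 hS
  · intro hT
    rw [hT, ← hC] at hST
    exact hSC.ne hST

/-- Two different loose cycles that share an edge span few vertices. -/
theorem card_biUnion_union [DecidableEq α] {ℓ' : ℕ} [NeZero ℓ] [Fact (1 < ℓ)] [NeZero ℓ']
    [Fact (1 < ℓ')] {B : Finset α} (hC : LooseOn G ℓ C) (hB : LooseOn G ℓ' B)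
    (hk : ∀ j, (G j).card = k) (hne : C ≠ B) (hint : (C ∩ B).Nonempty) :
    ((C ∪ B).biUnion G).card + 1 ≤ (k - 1) * (C ∪ B).card := by
  -- As C ≠ B, the shared edges form a proper part of at least one of the two cycles.
  have hlow : (k - 1) * (C ∩ B).card + 1 ≤ ((C ∩ B).biUnion G).card := by
    by_cases h : C ∩ B = C
    · have h' : C ∩ B ⊂ B :=
        Finset.ssubset_iff_subset_ne.2 ⟨Finset.inter_subset_right, fun h' => hne (h.symm.trans h')⟩
      exact hB.card_biUnion_lower hk hint h'
    · exact hC.card_biUnion_lower hk hint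
        (Finset.ssubset_iff_subset_ne.2 ⟨Finset.inter_subset_left, h⟩)
  -- Inclusion–exclusion for vertices against that for edges: the extra vertex in the overlap is the
  -- one saved in the union.
  have h1 := Finset.card_union_add_card_inter (C.biUnion G) (B.biUnion G)
  have h2 : ((C ∩ B).biUnion G).card ≤ (C.biUnion G ∩ B.biUnion G).card :=
    Finset.card_le_card (Finset.subset_inter
      (Finset.biUnion_subset_biUnion_of_subset_left _ Finset.inter_subset_left)
      (Finset.biUnion_subset_biUnion_of_subset_left _ Finset.inter_subset_right))
  have h3 := hC.card_biUnion_upper hk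
  have h4 := hB.card_biUnion_upper hk
  have h5 := congrArg ((k - 1) * ·) (Finset.card_union_add_card_inter C B)
  simp only [mul_add] at h5
  rw [Finset.union_biUnion]
  omega

end LooseOn

end Cycles

/-! ### Independent random edges from a family of sets -/

section RandomFamily

variable {α V : Type*} [Fintype α] [DecidableEq α] [Fintype V] [DecidableEq V]
  {𝓕 : Finset (Finset V)}

/-- The edges of an `α`-indexed family of members of `𝓕`. -/
def edges (H : α → 𝓕) : α → Finset V := fun j => (H j).1

/-- The number of members of `𝓕` that contain `u` and `w`. -/
def codegree (𝓕 : Finset (Finset V)) (u w : V) : ℕ := (𝓕.filter fun E => u ∈ E ∧ w ∈ E).card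

theorem card_edges {k : ℕ} (hk : ∀ E ∈ 𝓕, E.card = k) (H : α → 𝓕) (j : α) :
    (edges H j).card = k := hk _ (H j).2

/-- It is unlikely that many random edges span few vertices. -/
theorem pr_card_biUnion_le (h𝓕 : 𝓕.Nonempty) (U : Finset α) {N : ℕ} (hN : N ≤ Fintype.card V) :
    pr (fun H : α → 𝓕 => (U.biUnion (edges H)).card ≤ N) ≤
      (Fintype.card V : ℝ) ^ N * (2 ^ N / 𝓕.card) ^ U.card := by
  classical
  have : Nonempty 𝓕 := h𝓕.to_subtype
  -- Union bound over the N-sets W that contain all the edges; at most 2^N members of 𝓕 lie inside a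
  -- given W.
  have h1 : pr (fun H : α → 𝓕 => (U.biUnion (edges H)).card ≤ N) ≤
      pr (fun H : α → 𝓕 => ∃ W ∈ Finset.powersetCard N (Finset.univ : Finset V),
        ∀ c : U, H c.1 ∈ Finset.univ.filter fun E : 𝓕 => E.1 ⊆ W) := by
    refine pr_mono fun H hH => ?_
    obtain ⟨W, hUW, hW⟩ := Finset.exists_superset_card_eq hH hN
    refine ⟨W, by simp [Finset.mem_powersetCard, hW], fun c => ?_⟩
    simp only [Finset.mem_filter, Finset.mem_univ, true_and]
    exact (Finset.subset_biUnion_of_mem (edges H) c.2).trans hUW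
  refine h1.trans ((pr_exists_le_sum _ _).trans ?_)
  have h2 : ∀ W ∈ Finset.powersetCard N (Finset.univ : Finset V),
      pr (fun H : α → 𝓕 => ∀ c : U, H c.1 ∈ Finset.univ.filter fun E : 𝓕 => E.1 ⊆ W) ≤
        (2 ^ N / 𝓕.card) ^ U.card := by
    intro W hW
    rw [pr_forall_mem_comp (fun c : U => c.1) Subtype.val_injective
      (fun _ => Finset.univ.filter fun E : 𝓕 => E.1 ⊆ W)]
    rw [Finset.prod_const, Finset.card_univ, Fintype.card_coe, Fintype.card_coe]
    gcongr
    have : (Finset.univ.filter fun E : 𝓕 => E.1 ⊆ W).card ≤ W.powerset.card := by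
      refine Finset.card_le_card_of_injOn (fun E => E.1) ?_ Subtype.val_injective.injOn
      intro E hE
      simpa using hE
    rw [Finset.card_powerset, (Finset.mem_powersetCard.1 hW).2] at this
    exact_mod_cast this
  refine (Finset.sum_le_card_nsmul _ _ _ h2).trans ?_
  rw [nsmul_eq_mul, Finset.card_powersetCard, Finset.card_univ]
  gcongr
  exact_mod_cast Nat.choose_le_pow _ _

open Classical in
theorem card_isCycleOrder {ℓ : ℕ} [NeZero ℓ] [Fact (1 < ℓ)] (G : α → Finset V) :
    (Finset.univ.filter fun p : (ZMod ℓ → α) × (ZMod ℓ → V) => IsCycleOrder G p.1 p.2).card =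
      2 * ℓ * (Finset.univ.filter fun A : Finset α => LooseOn G ℓ A).card := by
  rw [Finset.card_eq_sum_card_fiberwise (f := fun p => Finset.univ.image p.1)
    (t := Finset.univ.filter fun A : Finset α => LooseOn G ℓ A), Finset.sum_const_nat (m := 2 * ℓ),
    mul_comm]
  · intro A hA
    obtain ⟨e, v, h, hr⟩ := (Finset.mem_filter.1 hA).2
    rw [← h.card_orders, Finset.filter_filter]
    congr 1
    ext p
    simp only [Finset.mem_filter, Finset.mem_univ, true_and]
    refine and_congr_right fun _ => ?_
    rw [hr, ← Finset.coe_inj]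
    simp
  · rintro ⟨e, v⟩ h
    have h : IsCycleOrder G e v := by simpa using h
    simp only [Finset.coe_filter, Finset.mem_univ, true_and, Set.mem_ofPred_eq]
    exact ⟨e, v, h, by simp⟩

/-- This is the source of the factor 1/(2ℓ) in λ_ℓ. -/
theorem sum_pr_looseOn {ℓ : ℕ} [NeZero ℓ] [Fact (1 < ℓ)] :
    2 * (ℓ : ℝ) * ∑ A : Finset α, pr (fun H : α → 𝓕 => LooseOn (edges H) ℓ A) =
      ∑ p : (ZMod ℓ → α) × (ZMod ℓ → V),
        pr (fun H : α → 𝓕 => IsCycleOrder (edges H) p.1 p.2) := by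
  classical
  rw [sum_pr_eq, sum_pr_eq, mul_div_assoc', Finset.mul_sum]
  congr 1
  refine Finset.sum_congr rfl fun H _ => ?_
  have := card_isCycleOrder (ℓ := ℓ) (edges H)
  exact_mod_cast this.symm

/-- The probability that given edges pass cyclically through given vertices, computed from the
codegrees. -/
theorem pr_incident {ℓ : ℕ} [NeZero ℓ] (h𝓕 : 𝓕.Nonempty) {e : ZMod ℓ → α}
    (he : Function.Injective e) (v : ZMod ℓ → V) :
    pr (fun H : α → 𝓕 => ∀ a, v a ∈ edges H (e a) ∧ v (a + 1) ∈ edges H (e a)) =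
      ∏ a, ((codegree 𝓕 (v a) (v (a + 1)) : ℝ) / 𝓕.card) := by
  classical
  have : Nonempty 𝓕 := h𝓕.to_subtype
  have := pr_forall_mem_comp e he
    (fun a => Finset.univ.filter fun E : 𝓕 => v a ∈ E.1 ∧ v (a + 1) ∈ E.1)
  simp only [Finset.mem_filter, Finset.mem_univ, true_and, Fintype.card_coe] at this
  unfold edges
  rw [this]
  refine Finset.prod_congr rfl fun a _ => ?_
  congr 2
  unfold codegree
  refine Finset.card_bij (fun E _ => E.1) ?_ ?_ ?_
  · intro E hE
    simpa using hE
  · intro E _ E' _ h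
    exact Subtype.ext h
  · intro E hE
    simp only [Finset.mem_filter] at hE
    exact ⟨⟨E, hE.1⟩, by simpa using hE.2, rfl⟩

open Classical in
/-- The expected number of cyclic orders is close to the expected number of cyclic incidences. -/
theorem abs_sum_pr_isCycleOrder_sub_le {ℓ : ℕ} [NeZero ℓ] [Fact (1 < ℓ)] {k : ℕ} (h𝓕 : 𝓕.Nonempty)
    (hk : ∀ E ∈ 𝓕, E.card = k) (hk2 : 2 ≤ k) (hn : (k - 1) * ℓ - 1 ≤ Fintype.card V) :
    |∑ p : (ZMod ℓ → α) × (ZMod ℓ → V), pr (fun H : α → 𝓕 => IsCycleOrder (edges H) p.1 p.2) -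
      (Fintype.card α).descFactorial ℓ * ∑ v : ZMod ℓ → V with Function.Injective v,
        ∏ a, ((codegree 𝓕 (v a) (v (a + 1)) : ℝ) / 𝓕.card)| ≤
      (Fintype.card α : ℝ) ^ ℓ * (k ^ ℓ * ((Fintype.card V : ℝ) ^ ((k - 1) * ℓ - 1) *
        (2 ^ ((k - 1) * ℓ - 1) / 𝓕.card) ^ ℓ)) := by
  set N := (k - 1) * ℓ - 1 with hNdef
  have hNpos : 1 ≤ (k - 1) * ℓ := Nat.mul_pos (by omega) (NeZero.pos ℓ)
  set Ev := Finset.univ.filter fun e : ZMod ℓ → α => Function.Injective e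
  set Vv := Finset.univ.filter fun v : ZMod ℓ → V => Function.Injective v
  have hEcard : Ev.card = (Fintype.card α).descFactorial ℓ := by
    have h := Fintype.card_embedding_eq (α := ZMod ℓ) (β := α)
    rw [ZMod.card] at h
    rw [← h, ← Fintype.card_subtype]
    exact Fintype.card_congr (Equiv.subtypeInjectiveEquivEmbedding _ _)
  have hsum : ∑ p : (ZMod ℓ → α) × (ZMod ℓ → V),
      pr (fun H : α → 𝓕 => IsCycleOrder (edges H) p.1 p.2) =
      ∑ e ∈ Ev, ∑ v ∈ Vv, pr (fun H : α → 𝓕 => IsCycleOrder (edges H) e v) := by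
    rw [← Finset.sum_product']
    refine (Finset.sum_subset (Finset.subset_univ _) fun p _ hp => ?_).symm
    rw [pr_eq_card, Finset.filter_false_of_mem]
    · simp
    · intro H _ hH
      exact hp (by simp [Ev, Vv, hH.1, hH.2.1])
  rw [hsum, ← hEcard, ← nsmul_eq_mul, ← Finset.sum_const, ← Finset.sum_sub_distrib]
  refine (Finset.abs_sum_le_sum_abs _ _).trans ?_
  have hmain : ∀ e ∈ Ev, |∑ v ∈ Vv, pr (fun H : α → 𝓕 => IsCycleOrder (edges H) e v) -
      ∑ v ∈ Vv, ∏ a, ((codegree 𝓕 (v a) (v (a + 1)) : ℝ) / 𝓕.card)| ≤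
      k ^ ℓ * ((Fintype.card V : ℝ) ^ N * (2 ^ N / 𝓕.card) ^ ℓ) := by
    intro e he
    have he : Function.Injective e := by simpa [Ev] using he
    rw [← Finset.sum_sub_distrib]
    refine (Finset.abs_sum_le_sum_abs _ _).trans ?_
    -- A cyclic order forces the incidences; the converse fails only if the edges have further
    -- intersections, hence span at most (k − 1)ℓ − 1 vertices.
    have h1 : ∀ v ∈ Vv, |pr (fun H : α → 𝓕 => IsCycleOrder (edges H) e v) -
        ∏ a, ((codegree 𝓕 (v a) (v (a + 1)) : ℝ) / 𝓕.card)| ≤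
        pr (fun H : α → 𝓕 => (∀ a, v a ∈ edges H (e a) ∧ v (a + 1) ∈ edges H (e a)) ∧
          ¬ IsCycleOrder (edges H) e v) := by
      intro v _
      rw [← pr_incident h𝓕 he]
      refine abs_pr_sub_le fun H hH => ⟨fun h a => ⟨h.mem_left a, h.mem_right a⟩, fun h => ?_⟩
      by_contra hcon
      exact hH ⟨h, hcon⟩
    refine (Finset.sum_le_sum h1).trans ?_
    rw [sum_pr_eq]
    have h2 := pr_card_biUnion_le (α := α) h𝓕 (Finset.univ.image e) hn
    rw [Finset.card_image_of_injective _ he, Finset.card_univ, ZMod.card] at h2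
    refine le_trans ?_ (mul_le_mul_of_nonneg_left h2 (by positivity))
    rw [pr_eq_sum, mul_div_assoc', Finset.mul_sum]
    gcongr with H
    split_ifs with hfew
    -- For fixed edges each `v a` is one of the k vertices of its edge, which gives the factor k^ℓ.
    · have h3 : (Vv.filter fun v => (∀ a, v a ∈ edges H (e a) ∧ v (a + 1) ∈ edges H (e a)) ∧
          ¬ IsCycleOrder (edges H) e v).card ≤
          (Fintype.piFinset fun a => edges H (e a)).card := by
        refine Finset.card_le_card fun v hv => ?_
        rw [Fintype.mem_piFinset]
        exact fun a => ((Finset.mem_filter.1 hv).2.1 a).1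
      rw [Fintype.card_piFinset, Finset.prod_congr rfl fun a _ => card_edges hk H (e a),
        Finset.prod_const, Finset.card_univ, ZMod.card] at h3
      rw [mul_one]
      exact_mod_cast h3
    · rw [mul_zero]
      refine le_of_eq ?_
      rw [Nat.cast_eq_zero, Finset.card_eq_zero]
      refine Finset.eq_empty_of_forall_notMem fun v hv => hfew ?_
      simp only [Finset.mem_filter] at hv
      obtain ⟨hv, h3, h4⟩ := hv
      have := card_biUnion_of_not_isCycleOrder (card_edges hk H) he
        (by simpa [Vv] using hv) (fun a => (h3 a).1) (fun a => (h3 a).2) h4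
      rw [Finset.image_biUnion]
      omega
  refine (Finset.sum_le_card_nsmul _ _ _ hmain).trans ?_
  rw [nsmul_eq_mul, hEcard]
  gcongr
  exact_mod_cast Nat.descFactorial_le_pow _ _

end RandomFamily

/-! ### Error terms and the Poisson limit for cycle counts -/

section PoissonLimit

/-- The sum over all pairs of sets of a bound that depends only on the union. -/
theorem sum_union_le {α J : Type*} [Fintype α] [DecidableEq α] [Fintype J] (R : ℕ) (g : ℕ → ℝ)
    (hg : ∀ t, 0 ≤ g t) (f : J × Finset α → J × Finset α → ℝ)
    (hf : ∀ b b', f b b' ≤ if (b.2 ∪ b'.2).card ≤ R then g (b.2 ∪ b'.2).card else 0) :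
    ∑ b, ∑ b', f b b' ≤ ∑ t ∈ Finset.range (R + 1),
      (Fintype.card J * 2 ^ R) ^ 2 * ((Fintype.card α : ℝ) ^ t * g t) := by
  classical
  set S := (Finset.univ : Finset ((J × Finset α) × (J × Finset α)))
  set h : Finset α → ℝ := fun U => if U.card ≤ R then g U.card else 0 with hh
  have hh0 : ∀ U, 0 ≤ h U := fun U => by
    simp only [hh]
    split_ifs
    · exact hg _
    · exact le_rfl
  rw [← Finset.sum_product', Finset.univ_product_univ]
  calc ∑ p ∈ S, f p.1 p.2 ≤ ∑ p ∈ S, h (p.1.2 ∪ p.2.2) := Finset.sum_le_sum fun p _ => hf _ _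
    _ = ∑ U : Finset α, ∑ p ∈ S with p.1.2 ∪ p.2.2 = U, h (p.1.2 ∪ p.2.2) :=
        (Finset.sum_fiberwise _ _ _).symm
    _ ≤ ∑ U : Finset α, (Fintype.card J * 2 ^ R) ^ 2 * h U := by
        refine Finset.sum_le_sum fun U _ => ?_
        rw [Finset.sum_congr rfl (g := fun _ => h U) fun p hp => by
          rw [(Finset.mem_filter.1 hp).2], Finset.sum_const, nsmul_eq_mul]
        by_cases hU : U.card ≤ R
        · refine mul_le_mul_of_nonneg_right ?_ (hh0 U)
          -- Both edge sets of such a pair are subsets of U, and each carries a label in J.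
          have hsub : (S.filter fun p => p.1.2 ∪ p.2.2 = U) ⊆
              (Finset.univ ×ˢ U.powerset) ×ˢ (Finset.univ ×ˢ U.powerset) := by
            intro p hp
            have := (Finset.mem_filter.1 hp).2
            simp only [Finset.mem_product, Finset.mem_univ, true_and, Finset.mem_powerset]
            rw [← this]
            exact ⟨Finset.subset_union_left, Finset.subset_union_right⟩
          have := Finset.card_le_card hsub
          rw [Finset.card_product, Finset.card_product, Finset.card_powerset,
            Finset.card_univ, ← sq] at this
          have h2 : (2 : ℕ) ^ U.card ≤ 2 ^ R := Nat.pow_le_pow_right (by norm_num) hU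
          exact_mod_cast this.trans (Nat.pow_le_pow_left (Nat.mul_le_mul_left _ h2) 2)
        · simp [hh, hU]
    _ ≤ _ := by
        rw [← Finset.mul_sum, ← Finset.mul_sum]
        refine mul_le_mul_of_nonneg_left ?_ (by positivity)
        simp only [hh]
        rw [← Finset.sum_filter, ← Finset.sum_fiberwise_of_maps_to (t := Finset.range (R + 1))
          (g := Finset.card) (fun U hU => by
            have := (Finset.mem_filter.1 hU).2
            simpa [Nat.lt_succ_iff] using this)]
        refine Finset.sum_le_sum fun t _ => ?_
        rw [Finset.sum_congr rfl (g := fun _ => g t) fun p hp => by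
          rw [(Finset.mem_filter.1 hp).2], Finset.sum_const, nsmul_eq_mul]
        refine mul_le_mul_of_nonneg_right ?_ (hg t)
        have hsub : ((Finset.univ.filter fun U : Finset α => U.card ≤ R).filter
            fun U => U.card = t) ⊆ Finset.powersetCard t Finset.univ := by
          intro U hU
          simp [Finset.mem_powersetCard, (Finset.mem_filter.1 hU).2]
        have := Finset.card_le_card hsub
        rw [Finset.card_powersetCard, Finset.card_univ] at this
        exact_mod_cast this.trans (Nat.choose_le_pow _ _)

section Pairs

variable {α V : Type*} [Fintype α] [DecidableEq α] [Fintype V] [DecidableEq V]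
  {𝓕 : Finset (Finset V)} {k L : ℕ} {φ : ℝ}

/-- The constant in the bounds for the probability of a configuration of `t` edges. -/
noncomputable def edgeConst (k L : ℕ) (φ : ℝ) : ℝ :=
  (2 ^ (2 * k * L) / φ + 1) ^ (2 * L)

/-- There are O(n^N) vertex sets, and each of the |U| edges lies in a given one with probability
O(n^{-k}). So every vertex missing from k|U| gains a factor 1/n. -/
theorem pr_few_le (hφ : 0 < φ) (hφ𝓕 : φ * (Fintype.card V : ℝ) ^ k ≤ 𝓕.card)
    (hn : 2 * k * L ≤ Fintype.card V) (hn1 : 1 ≤ Fintype.card V) {U : Finset α} (hU : U.card ≤ 2 * L)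
    {N r : ℕ} (hN : N + r = k * U.card) :
    pr (fun H : α → 𝓕 => (U.biUnion (edges H)).card ≤ N) ≤
      edgeConst k L φ / (Fintype.card V : ℝ) ^ r := by
  have hV : (0 : ℝ) < Fintype.card V := by exact_mod_cast hn1
  have hc : (0 : ℝ) < 𝓕.card := lt_of_lt_of_le (by positivity) hφ𝓕
  have h𝓕 : 𝓕.Nonempty := Finset.card_pos.1 (by exact_mod_cast hc)
  have hN2 : N ≤ 2 * k * L := by nlinarith
  refine (pr_card_biUnion_le h𝓕 U (hN2.trans hn)).trans ?_
  have h1 : (2 ^ N / (𝓕.card : ℝ)) ≤ (2 ^ (2 * k * L) / φ + 1) / (Fintype.card V : ℝ) ^ k := by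
    rw [div_le_div_iff₀ hc (by positivity)]
    have h2 : (2 : ℝ) ^ N ≤ 2 ^ (2 * k * L) := pow_le_pow_right₀ (by norm_num) hN2
    have h3 : (2 : ℝ) ^ (2 * k * L) / φ * (φ * (Fintype.card V : ℝ) ^ k) ≤
      2 ^ (2 * k * L) / φ * 𝓕.card := mul_le_mul_of_nonneg_left hφ𝓕 (by positivity)
    have h4 : (2 : ℝ) ^ (2 * k * L) / φ * (φ * (Fintype.card V : ℝ) ^ k) =
      2 ^ (2 * k * L) * (Fintype.card V : ℝ) ^ k := by field_simp
    have h5 := mul_le_mul_of_nonneg_right h2 (by positivity : 0 ≤ (Fintype.card V : ℝ) ^ k)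
    nlinarith
  calc (Fintype.card V : ℝ) ^ N * (2 ^ N / (𝓕.card : ℝ)) ^ U.card
      ≤ (Fintype.card V : ℝ) ^ N *
        ((2 ^ (2 * k * L) / φ + 1) / (Fintype.card V : ℝ) ^ k) ^ U.card := by gcongr
    _ = (2 ^ (2 * k * L) / φ + 1) ^ U.card / (Fintype.card V : ℝ) ^ r := by
        rw [div_pow, ← pow_mul, ← hN, pow_add]
        field_simp
    _ ≤ _ := by
        -- The summand 1 makes the base at least 1, so that the exponent |U| can be raised to 2L.
        unfold edgeConst
        gcongr
        rw [le_add_iff_nonneg_left]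
        positivity

theorem edgeConst_pos (hφ : 0 < φ) : 0 < edgeConst k L φ := by
  unfold edgeConst; positivity

/-- The contribution of a pair of edge sets to the error term of the Poisson recursion. -/
theorem pair_term_le (hk : ∀ E ∈ 𝓕, E.card = k) (hk2 : 2 ≤ k) (hφ : 0 < φ)
    (hφ𝓕 : φ * (Fintype.card V : ℝ) ^ k ≤ 𝓕.card)
    (hn : 2 * k * L ≤ Fintype.card V) (hn1 : 1 ≤ Fintype.card V)
    (b b' : Finset.Icc 2 L × Finset α) :
    (if ¬ Disjoint b.2 b'.2 ∨ b = b' then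
      (if b' = b then 0 else pr (fun H : α → 𝓕 => LooseOn (edges H) b.1 b.2 ∧
        LooseOn (edges H) b'.1 b'.2)) +
      pr (fun H : α → 𝓕 => LooseOn (edges H) b.1 b.2) *
        pr (fun H : α → 𝓕 => LooseOn (edges H) b'.1 b'.2) else 0) ≤
    if (b.2 ∪ b'.2).card ≤ 2 * L then
      (edgeConst k L φ + edgeConst k L φ ^ 2) / (Fintype.card V : ℝ) ^ ((b.2 ∪ b'.2).card + 1)
    else 0 := by
  obtain ⟨⟨j, hj⟩, A⟩ := b
  obtain ⟨⟨j', hj'⟩, B⟩ := b'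
  rw [Finset.mem_Icc] at hj hj'
  have : NeZero j := ⟨by omega⟩
  have : NeZero j' := ⟨by omega⟩
  have : Fact (1 < j) := ⟨by omega⟩
  have : Fact (1 < j') := ⟨by omega⟩
  have hC := edgeConst_pos (k := k) (L := L) hφ
  have hVpos : (0 : ℝ) < Fintype.card V := by exact_mod_cast hn1
  simp only
  have hzero : ∀ (i : ℕ) [NeZero i] (D : Finset α), D.card ≠ i →
      pr (fun H : α → 𝓕 => LooseOn (edges H) i D) = 0 := by
    intro i _ D hD
    rw [pr_congr (T := fun _ => False) fun H => ⟨fun h => hD h.card_eq, False.elim⟩]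
    simp [pr]
  have hjoint : 0 ≤ pr (fun H : α → 𝓕 => LooseOn (edges H) j A ∧ LooseOn (edges H) j' B) :=
    pr_nonneg _
  have hle1 : pr (fun H : α → 𝓕 => LooseOn (edges H) j A ∧ LooseOn (edges H) j' B) ≤
      pr (fun H : α → 𝓕 => LooseOn (edges H) j A) := pr_mono fun H h => h.1
  have hle2 : pr (fun H : α → 𝓕 => LooseOn (edges H) j A ∧ LooseOn (edges H) j' B) ≤
      pr (fun H : α → 𝓕 => LooseOn (edges H) j' B) := pr_mono fun H h => h.2
  have hrhs : 0 ≤ if (A ∪ B).card ≤ 2 * L then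
      (edgeConst k L φ + edgeConst k L φ ^ 2) / (Fintype.card V : ℝ) ^ ((A ∪ B).card + 1)
    else 0 := by
    split_ifs <;> positivity
  -- A set of the wrong size is never a cycle, and then both terms vanish.
  by_cases hA : A.card = j
  swap
  · have h0 := hzero j A hA
    have h1 := le_antisymm (hle1.trans h0.le) hjoint
    refine le_of_eq_of_le ?_ hrhs
    simp [h0, h1]
  by_cases hB : B.card = j'
  swap
  · have h0 := hzero j' B hB
    have h1 := le_antisymm (hle2.trans h0.le) hjoint
    refine le_of_eq_of_le ?_ hrhs
    simp [h0, h1]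
  by_cases hnb : ¬ Disjoint A B ∨ ((⟨j, Finset.mem_Icc.2 hj⟩ : Finset.Icc 2 L), A) =
      ((⟨j', Finset.mem_Icc.2 hj'⟩ : Finset.Icc 2 L), B)
  swap
  · rw [if_neg hnb]
    exact hrhs
  rw [if_pos hnb]
  have hint : (A ∩ B).Nonempty := by
    rcases hnb with h | h
    · exact Finset.not_disjoint_iff_nonempty_inter.1 h
    · have hAB : A = B := congrArg Prod.snd h
      rw [← hAB, Finset.inter_self, ← Finset.card_pos]
      omega
  have hcard := Finset.card_union_add_card_inter A B
  have hint' := Finset.card_pos.2 hint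
  have hAU := Finset.card_le_card (Finset.subset_union_left (s₁ := A) (s₂ := B))
  have hU : (A ∪ B).card ≤ 2 * L := by omega
  rw [if_pos hU, add_div]
  refine add_le_add ?_ ?_
  · split_ifs with hbb
    · positivity
    have hne : A ≠ B := by
      rintro rfl
      apply hbb
      simp only [Prod.mk.injEq, Subtype.mk.injEq, and_true]
      omega
    have hpos : 1 ≤ (k - 1) * (A ∪ B).card := Nat.mul_pos (by omega) (by omega)
    -- Spanning at most (k − 1)|A ∪ B| − 1 vertices is a deficit of |A ∪ B| + 1 from k|A ∪ B|.
    refine (pr_mono fun H h => ?_).trans (pr_few_le (U := A ∪ B) (N := (k - 1) * (A ∪ B).card - 1)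
      hφ hφ𝓕 hn hn1 hU ?_)
    · have := h.1.card_biUnion_union h.2 (card_edges hk H) hne hint
      omega
    · obtain ⟨s, rfl⟩ : ∃ s, k = s + 1 := ⟨k - 1, by omega⟩
      rw [Nat.add_sub_cancel, add_mul] at *
      omega
  -- Each cycle alone gives n^{-length}; a shared edge makes j + j' at least |A ∪ B| + 1.
  · have hone : ∀ (i : ℕ) [NeZero i] [Fact (1 < i)] (D : Finset α), i ≤ L → D.card = i →
        pr (fun H : α → 𝓕 => LooseOn (edges H) i D) ≤
          edgeConst k L φ / (Fintype.card V : ℝ) ^ i := by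
      intro i _ _ D hi hD
      refine (pr_mono fun H h => h.card_biUnion_upper (card_edges hk H)).trans
        (pr_few_le hφ hφ𝓕 hn hn1 (by omega) ?_)
      obtain ⟨s, rfl⟩ : ∃ s, k = s + 1 := ⟨k - 1, by omega⟩
      rw [Nat.add_sub_cancel, add_mul, hD, one_mul]
    calc _ ≤ (edgeConst k L φ / (Fintype.card V : ℝ) ^ j) *
          (edgeConst k L φ / (Fintype.card V : ℝ) ^ j') :=
          mul_le_mul (hone j A hj.2 hA) (hone j' B hj'.2 hB) (pr_nonneg _) (by positivity)
      _ = edgeConst k L φ ^ 2 / (Fintype.card V : ℝ) ^ (j + j') := by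
          rw [div_mul_div_comm, pow_add, sq]
      _ ≤ _ := by
          refine div_le_div_of_nonneg_left (by positivity) (by positivity) ?_
          exact pow_le_pow_right₀ (by exact_mod_cast hn1) (by omega)

/-- About m^t edge sets of size t meet a bound of order n^{-(t+1)}; with m of order n the total is
O(1/n). -/
theorem sum_pairs_le (hk : ∀ E ∈ 𝓕, E.card = k) (hk2 : 2 ≤ k) (hφ : 0 < φ)
    (hφ𝓕 : φ * (Fintype.card V : ℝ) ^ k ≤ 𝓕.card)
    (hn : 2 * k * L ≤ Fintype.card V) (hn1 : 1 ≤ Fintype.card V) :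
    ∑ b : Finset.Icc 2 L × Finset α, ∑ b' : Finset.Icc 2 L × Finset α
        with ¬ Disjoint b.2 b'.2 ∨ b = b',
      ((if b' = b then 0 else pr (fun H : α → 𝓕 => LooseOn (edges H) b.1 b.2 ∧
        LooseOn (edges H) b'.1 b'.2)) +
      pr (fun H : α → 𝓕 => LooseOn (edges H) b.1 b.2) *
        pr (fun H : α → 𝓕 => LooseOn (edges H) b'.1 b'.2)) ≤
      ∑ t ∈ Finset.range (2 * L + 1), (Fintype.card (Finset.Icc 2 L) * 2 ^ (2 * L)) ^ 2 *
        ((edgeConst k L φ + edgeConst k L φ ^ 2) *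
          (((Fintype.card α : ℝ) / Fintype.card V) ^ t * (Fintype.card V : ℝ)⁻¹)) := by
  have hVpos : (0 : ℝ) < Fintype.card V := by exact_mod_cast hn1
  have hC := edgeConst_pos (k := k) (L := L) hφ
  simp_rw [Finset.sum_filter]
  refine (sum_union_le (2 * L) (fun t => (edgeConst k L φ + edgeConst k L φ ^ 2) /
    (Fintype.card V : ℝ) ^ (t + 1)) (fun t => by positivity) _
    fun b b' => pair_term_le hk hk2 hφ hφ𝓕 hn hn1 b b').trans (le_of_eq ?_)
  refine Finset.sum_congr rfl fun t _ => ?_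
  rw [div_pow, pow_succ]
  field_simp
  ring

/-- The recursion hypothesis: a loose cycle is independent of those that share no edge with it. -/
theorem pr_looseOn_and_kindCount (b : Finset.Icc 2 L × Finset α) (y : Finset.Icc 2 L → ℕ) :
    pr (fun H : α → 𝓕 => LooseOn (edges H) b.1 b.2 ∧ ∀ j, kindCount Prod.fst
      (fun (b' : Finset.Icc 2 L × Finset α) H => LooseOn (edges H) b'.1 b'.2)
      (fun b' => ¬ (¬ Disjoint b.2 b'.2 ∨ b = b')) j H = y j) =
    pr (fun H : α → 𝓕 => LooseOn (edges H) b.1 b.2) * pr (fun H : α → 𝓕 => ∀ j, kindCount Prod.fst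
      (fun (b' : Finset.Icc 2 L × Finset α) H => LooseOn (edges H) b'.1 b'.2)
      (fun b' => ¬ (¬ Disjoint b.2 b'.2 ∨ b = b')) j H = y j) := by
  classical
  refine pr_and_of_disjoint b.2 ?_ ?_
  · intro H H' h
    exact ⟨LooseOn.congr fun a ha => by rw [edges, edges, h a ha],
      LooseOn.congr fun a ha => by rw [edges, edges, h a ha]⟩
  · intro H H' h
    have : ∀ j, kindCount Prod.fst
      (fun (b' : Finset.Icc 2 L × Finset α) (H : α → 𝓕) => LooseOn (edges H) b'.1 b'.2)
      (fun b' => ¬ (¬ Disjoint b.2 b'.2 ∨ b = b')) j H = kindCount Prod.fst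
      (fun (b' : Finset.Icc 2 L × Finset α) (H : α → 𝓕) => LooseOn (edges H) b'.1 b'.2)
      (fun b' => ¬ (¬ Disjoint b.2 b'.2 ∨ b = b')) j H' := by
      intro j
      unfold kindCount
      congr 1
      ext b'
      simp only [Finset.mem_filter, Finset.mem_univ, true_and]
      refine and_congr_right fun _ => and_congr_right fun hb => ?_
      push Not at hb
      have hd : ∀ a ∈ b'.2, edges H a = edges H' a := fun a ha => by
        rw [edges, edges, h a fun ha' => Finset.disjoint_left.1 hb.1 ha' ha]
      exact ⟨LooseOn.congr hd, LooseOn.congr fun a ha => (hd a ha).symm⟩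
    simp_rw [this]

open Classical in
theorem kindCount_looseOn (H : α → 𝓕) (j : Finset.Icc 2 L) :
    kindCount Prod.fst (fun (b : Finset.Icc 2 L × Finset α) (H : α → 𝓕) =>
      LooseOn (edges H) b.1 b.2) (fun _ => True) j H =
    (Finset.univ.filter fun A : Finset α => LooseOn (edges H) j A).card := by
  unfold kindCount
  symm
  refine Finset.card_bij (fun A _ => (j, A)) ?_ ?_ ?_
  · intro A hA
    simpa using hA
  · intro A _ B _ h
    exact congrArg Prod.snd h
  · rintro ⟨i, A⟩ h
    simp only [Finset.mem_filter, Finset.mem_univ, true_and] at h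
    obtain ⟨rfl, h⟩ := h
    exact ⟨A, by simpa using h, rfl⟩

end Pairs

/-! ### Asymptotic means and joint law -/

section Asymptotic

variable {ι : Type*} {l : Filter ι} {k L : ℕ} {N m : ι → ℕ}
  {𝓕 : ∀ i, Finset (Finset (Fin (N i)))} {c φ : ℝ}

theorem tendsto_sub_div {a : ι → ℕ} {ρ : ℝ} (hN : Tendsto N l atTop)
    (ha : Tendsto (fun i => (a i : ℝ) / N i) l (𝓝 ρ)) (s : ℕ) :
    Tendsto (fun i => ((a i - s : ℕ) : ℝ) / N i) l (𝓝 ρ) := by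
  have hNr : Tendsto (fun i => (N i : ℝ)) l atTop := tendsto_natCast_atTop_atTop.comp hN
  have h0 : Tendsto (fun i => (a i : ℝ) / N i - s / N i) l (𝓝 ρ) := by
    simpa using ha.sub (hNr.const_div_atTop (s : ℝ))
  refine tendsto_of_tendsto_of_tendsto_of_le_of_le h0 ha (fun i => ?_) fun i => ?_
  · simp only
    rw [← sub_div]
    gcongr
    rw [sub_le_iff_le_add]
    exact_mod_cast le_tsub_add
  · simp only
    gcongr
    exact Nat.sub_le _ _

theorem tendsto_descFactorial_div {a : ι → ℕ} {ρ : ℝ} (hN : Tendsto N l atTop)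
    (ha : Tendsto (fun i => (a i : ℝ) / N i) l (𝓝 ρ)) (r : ℕ) :
    Tendsto (fun i => ((a i).descFactorial r : ℝ) / (N i : ℝ) ^ r) l (𝓝 (ρ ^ r)) := by
  induction r with
  | zero => simpa using tendsto_const_nhds
  | succ r ih =>
    rw [pow_succ']
    refine ((tendsto_sub_div hN ha r).mul ih).congr fun i => ?_
    rw [Nat.descFactorial_succ, pow_succ', div_mul_div_comm]
    push_cast
    rfl

theorem tendsto_choose_div {a : ι → ℕ} {ρ : ℝ} (hN : Tendsto N l atTop)
    (ha : Tendsto (fun i => (a i : ℝ) / N i) l (𝓝 ρ)) (r : ℕ) :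
    Tendsto (fun i => ((a i).choose r : ℝ) / (N i : ℝ) ^ r) l (𝓝 (ρ ^ r / r.factorial)) := by
  refine ((tendsto_descFactorial_div hN ha r).div_const (r.factorial : ℝ)).congr fun i => ?_
  rw [Nat.descFactorial_eq_factorial_mul_choose]
  have : (r.factorial : ℝ) ≠ 0 := by exact_mod_cast r.factorial_ne_zero
  push_cast
  field_simp

/-- The expected number of loose cycles. -/
theorem tendsto_sum_pr_looseOn {ℓ : ℕ} [NeZero ℓ] (hℓ : 2 ≤ ℓ) (hk2 : 2 ≤ k)
    (hk : ∀ i, ∀ E ∈ 𝓕 i, E.card = k) (hN : Tendsto N l atTop)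
    (hm : Tendsto (fun i => (m i : ℝ) / N i) l (𝓝 c))
    (hφ : 0 < φ) (h𝓕 : Tendsto (fun i => ((𝓕 i).card : ℝ) / (N i : ℝ) ^ k) l (𝓝 φ)) {τ : ℝ}
    (hτ : Tendsto (fun i => (∑ v : ZMod ℓ → Fin (N i) with Function.Injective v,
      ∏ a, (codegree (𝓕 i) (v a) (v (a + 1)) : ℝ)) / (N i : ℝ) ^ ((k - 1) * ℓ)) l (𝓝 τ)) :
    Tendsto (fun i => ∑ A : Finset (Fin (m i)),
      pr (fun H : Fin (m i) → 𝓕 i => LooseOn (edges H) ℓ A)) l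
      (𝓝 ((c / φ) ^ ℓ * τ / (2 * ℓ))) := by
  classical
  have : Fact (1 < ℓ) := ⟨by omega⟩
  have hNr : Tendsto (fun i => (N i : ℝ)) l atTop := tendsto_natCast_atTop_atTop.comp hN
  have hN0 : ∀ᶠ i in l, (0 : ℝ) < N i := hNr.eventually_gt_atTop 0
  have hNinv : Tendsto (fun i => (N i : ℝ)⁻¹) l (𝓝 0) := hNr.inv_tendsto_atTop
  have hdesc : Tendsto (fun i => ((m i).descFactorial ℓ : ℝ) / (N i : ℝ) ^ ℓ) l (𝓝 (c ^ ℓ)) :=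
    tendsto_descFactorial_div hN hm ℓ
  have h𝓕inv : Tendsto (fun i => (N i : ℝ) ^ k / ((𝓕 i).card : ℝ)) l (𝓝 φ⁻¹) := by
    simpa using h𝓕.inv₀ hφ.ne'
  have h𝓕0 : ∀ᶠ i in l, (0 : ℝ) < (𝓕 i).card := by
    filter_upwards [h𝓕.eventually_const_lt hφ, hN0] with i hi hi'
    by_contra hcon
    have : ((𝓕 i).card : ℝ) = 0 := le_antisymm (not_lt.1 hcon) (Nat.cast_nonneg _)
    simp [this] at hi
  have hmain : Tendsto (fun i => ((m i).descFactorial ℓ : ℝ) *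
      ∑ v : ZMod ℓ → Fin (N i) with Function.Injective v,
        ∏ a, ((codegree (𝓕 i) (v a) (v (a + 1)) : ℝ) / (𝓕 i).card)) l
      (𝓝 (c ^ ℓ * (τ * φ⁻¹ ^ ℓ))) := by
    refine (hdesc.mul (hτ.mul (h𝓕inv.pow ℓ))).congr' ?_
    filter_upwards [hN0, h𝓕0] with i hi hi'
    simp_rw [Finset.prod_div_distrib, Finset.prod_const, Finset.card_univ, ZMod.card]
    rw [← Finset.sum_div]
    have hexp : (N i : ℝ) ^ (k * ℓ) = (N i : ℝ) ^ ((k - 1) * ℓ) * (N i : ℝ) ^ ℓ := by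
      rw [← pow_add]
      congr 1
      obtain ⟨s, rfl⟩ : ∃ s, k = s + 1 := ⟨k - 1, by omega⟩
      rw [Nat.add_sub_cancel]
      ring
    rw [div_pow, ← pow_mul, hexp]
    field_simp
  have herr : Tendsto (fun i => (Fintype.card (Fin (m i)) : ℝ) ^ ℓ * (k ^ ℓ *
      ((Fintype.card (Fin (N i)) : ℝ) ^ ((k - 1) * ℓ - 1) *
        (2 ^ ((k - 1) * ℓ - 1) / (𝓕 i).card) ^ ℓ))) l (𝓝 0) := by
    -- The powers of N balance except for the one vertex lost in a degenerate configuration, which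
    -- leaves 1/N.
    have h1 := (((hm.pow ℓ).mul (h𝓕inv.pow ℓ)).mul hNinv).const_mul
      ((k : ℝ) ^ ℓ * (2 ^ ((k - 1) * ℓ - 1)) ^ ℓ)
    rw [mul_zero, mul_zero] at h1
    refine h1.congr' ?_
    filter_upwards [hN0, h𝓕0] with i hi hi'
    have hexp : (N i : ℝ) ^ (k * ℓ) = (N i : ℝ) ^ ((k - 1) * ℓ - 1) * (N i : ℝ) ^ (ℓ + 1) := by
      rw [← pow_add]
      congr 1
      have hpos : 1 ≤ (k - 1) * ℓ := Nat.mul_pos (by omega) (NeZero.pos ℓ)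
      obtain ⟨s, rfl⟩ : ∃ s, k = s + 1 := ⟨k - 1, by omega⟩
      rw [Nat.add_sub_cancel] at *
      rw [add_mul]
      omega
    simp only [div_pow, ← pow_mul, Fintype.card_fin]
    rw [hexp, pow_succ]
    field_simp
  have hsum : Tendsto (fun i => ∑ p : (ZMod ℓ → Fin (m i)) × (ZMod ℓ → Fin (N i)),
      pr (fun H : Fin (m i) → 𝓕 i => IsCycleOrder (edges H) p.1 p.2)) l
      (𝓝 (c ^ ℓ * (τ * φ⁻¹ ^ ℓ))) := by
    have hdiff : Tendsto (fun i => (∑ p : (ZMod ℓ → Fin (m i)) × (ZMod ℓ → Fin (N i)),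
        pr (fun H : Fin (m i) → 𝓕 i => IsCycleOrder (edges H) p.1 p.2)) -
        ((m i).descFactorial ℓ : ℝ) * ∑ v : ZMod ℓ → Fin (N i) with Function.Injective v,
        ∏ a, ((codegree (𝓕 i) (v a) (v (a + 1)) : ℝ) / (𝓕 i).card)) l (𝓝 0) := by
      refine squeeze_zero_norm' ?_ herr
      filter_upwards [h𝓕0, hN.eventually_ge_atTop ((k - 1) * ℓ - 1)] with i hi hi'
      have := abs_sum_pr_isCycleOrder_sub_le (α := Fin (m i)) (ℓ := ℓ)
        (Finset.card_pos.1 (by exact_mod_cast hi)) (hk i) hk2 (by simpa using hi')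
      rw [Real.norm_eq_abs]
      convert this using 3
      simp
    simpa using hdiff.add hmain
  have hℓ0 : (ℓ : ℝ) ≠ 0 := by exact_mod_cast NeZero.ne ℓ
  have hfin := hsum.div_const (2 * (ℓ : ℝ))
  simp_rw [← sum_pr_looseOn] at hfin
  refine (hfin.congr fun i => ?_).trans (le_of_eq ?_)
  · field_simp
  · congr 1
    rw [div_pow, inv_pow]
    field_simp

open Classical in
/-- The numbers of loose cycles of lengths `2, …, L` are asymptotically independent Poisson
variables. -/
theorem tendsto_pr_looseOn_counts (hk2 : 2 ≤ k)
    (hk : ∀ i, ∀ E ∈ 𝓕 i, E.card = k) (hN : Tendsto N l atTop)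
    (hm : Tendsto (fun i => (m i : ℝ) / N i) l (𝓝 c))
    (hφ : 0 < φ) (h𝓕 : Tendsto (fun i => ((𝓕 i).card : ℝ) / (N i : ℝ) ^ k) l (𝓝 φ)) {τ : ℕ → ℝ}
    (hτ : ∀ (ℓ : ℕ) [NeZero ℓ], 2 ≤ ℓ → ℓ ≤ L →
      Tendsto (fun i => (∑ v : ZMod ℓ → Fin (N i) with Function.Injective v,
      ∏ a, (codegree (𝓕 i) (v a) (v (a + 1)) : ℝ)) / (N i : ℝ) ^ ((k - 1) * ℓ)) l (𝓝 (τ ℓ)))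
    (x : ℕ → ℕ) :
    Tendsto (fun i => pr (fun H : Fin (m i) → 𝓕 i => ∀ ℓ, 2 ≤ ℓ → ℓ ≤ L →
      (Finset.univ.filter fun A => LooseOn (edges H) ℓ A).card = x ℓ)) l
      (𝓝 (∏ ℓ ∈ Finset.Icc 2 L, poissonProb ((c / φ) ^ ℓ * τ ℓ / (2 * ℓ)) (x ℓ))) := by
  set J := Finset.Icc 2 L
  let I : ∀ i, J × Finset (Fin (m i)) → (Fin (m i) → 𝓕 i) → Prop :=
    fun i b H => LooseOn (edges H) b.1 b.2
  let P : ι → (J → ℕ) → ℝ := fun i x =>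
    pr (fun H => ∀ j, kindCount Prod.fst (I i) (fun _ => True) j H = x j)
  let M : ι → J → ℝ := fun i j => ∑ b : J × Finset (Fin (m i)) with b.1 = j, pr (I i b)
  have hNr : Tendsto (fun i => (N i : ℝ)) l atTop := tendsto_natCast_atTop_atTop.comp hN
  have hN0 : ∀ᶠ i in l, (0 : ℝ) < N i := hNr.eventually_gt_atTop 0
  have hNinv : Tendsto (fun i => (N i : ℝ)⁻¹) l (𝓝 0) := hNr.inv_tendsto_atTop
  have h𝓕lb : ∀ᶠ i in l, φ / 2 * (N i : ℝ) ^ k ≤ (𝓕 i).card := by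
    filter_upwards [h𝓕.eventually_const_lt (half_lt_self hφ), hN0] with i hi hi'
    rw [lt_div_iff₀ (by positivity)] at hi
    exact hi.le
  have hlim := tendsto_poisson_of_recursion (l := l) (P := P) (M := M)
    (μ := fun j => (c / φ) ^ (j : ℕ) * τ j / (2 * (j : ℕ))) (fun i x => pr_nonneg _)
    (fun i s => sum_pr_count_le_one _ s) ?_ ?_ ?_ (fun j => x j)
  · rw [Finset.prod_coe_sort J (fun ℓ => poissonProb ((c / φ) ^ ℓ * τ ℓ / (2 * ℓ)) (x ℓ))] at hlim
    refine hlim.congr fun i => pr_congr fun H => ?_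
    have hcount : ∀ j : J, kindCount Prod.fst (I i) (fun _ => True) j H =
        (Finset.univ.filter fun A => LooseOn (edges H) j A).card := fun j => kindCount_looseOn H j
    change (∀ j, kindCount Prod.fst (I i) (fun _ => True) j H = x j) ↔ _
    simp only [hcount]
    constructor
    · intro h ℓ h1 h2
      convert h ⟨ℓ, Finset.mem_Icc.2 ⟨h1, h2⟩⟩
    · rintro h ⟨ℓ, hℓ⟩
      rw [Finset.mem_Icc] at hℓ
      convert h ℓ hℓ.1 hℓ.2
  · filter_upwards [h𝓕lb, hN0] with i hi hi' K
    have hne : (𝓕 i).Nonempty := by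
      rw [← Finset.card_pos]
      have : (0 : ℝ) < (𝓕 i).card := lt_of_lt_of_le (by positivity) hi
      exact_mod_cast this
    have : Nonempty (𝓕 i) := hne.to_subtype
    have h := one_sub_le_sum_pr (Ω := Fin (m i) → 𝓕 i) Prod.fst (I i) K
    have hMsum : ∑ j, M i j = ∑ b, pr (I i b) := Finset.sum_fiberwise _ _ _
    rw [hMsum]
    convert h
  · rintro ⟨ℓ, hℓ⟩
    have hℓ' := Finset.mem_Icc.1 hℓ
    have : NeZero ℓ := ⟨by omega⟩
    have h := tendsto_sum_pr_looseOn hℓ'.1 hk2 hk hN hm hφ h𝓕 (hτ ℓ hℓ'.1 hℓ'.2)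
    refine h.congr fun i => ?_
    simp only [M]
    refine Finset.sum_bij (fun A _ => ((⟨ℓ, hℓ⟩ : J), A)) ?_ ?_ ?_ ?_
    · intro A _
      simp
    · intro A _ B _ h
      exact congrArg Prod.snd h
    · rintro ⟨j, A⟩ h
      simp only [Finset.mem_filter, Finset.mem_univ, true_and] at h
      exact ⟨A, Finset.mem_univ _, by rw [h]⟩
    · intro A _
      rfl
  · intro x j hx
    have hbound : Tendsto (fun i => ∑ t ∈ Finset.range (2 * L + 1),
        ((Fintype.card J * 2 ^ (2 * L)) ^ 2 : ℝ) *
        ((edgeConst k L (φ / 2) + edgeConst k L (φ / 2) ^ 2) *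
          (((m i : ℝ) / N i) ^ t * (N i : ℝ)⁻¹))) l (𝓝 0) := by
      have h := tendsto_finsetSum (Finset.range (2 * L + 1)) fun t _ =>
        (((hm.pow t).mul hNinv).const_mul
          (edgeConst k L (φ / 2) + edgeConst k L (φ / 2) ^ 2)).const_mul
          ((Fintype.card J * 2 ^ (2 * L)) ^ 2 : ℝ)
      simp only [mul_zero, Finset.sum_const_zero] at h
      exact h
    refine squeeze_zero_norm' ?_ hbound
    filter_upwards [h𝓕lb, hN.eventually_ge_atTop (2 * k * L), hN.eventually_ge_atTop 1]
      with i h1 h2 h3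
    have hrec := abs_mul_pr_sub_le (Ω := Fin (m i) → 𝓕 i) Prod.fst (I i)
      (fun b b' => ¬ Disjoint b.2 b'.2 ∨ b = b') (fun b => Or.inr rfl)
      (fun b y => pr_looseOn_and_kindCount b y) x j hx
    have hpairs := sum_pairs_le (α := Fin (m i)) (L := L) (hk i) hk2 (half_pos hφ)
      (by simpa using h1) (by simpa using h2) (by simpa using h3)
    simp only [Fintype.card_fin] at hpairs
    rw [Real.norm_eq_abs]
    refine le_trans (le_of_eq ?_) (hrec.trans (le_trans (le_of_eq ?_) hpairs))
    · simp only [P, M]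
    · simp only [I]
      congr!

end Asymptotic

end PoissonLimit

/-! ### Closed walks and the trace of the Potts matrix -/

section ClosedWalks

variable {Q : Type*} [Fintype Q] [DecidableEq Q]

/-- An arbitrary weight `g` on the two ends is what makes the induction work: the first step of the
walk is absorbed into `g`. -/
theorem sum_path_prod (M : Matrix Q Q ℝ) (n : ℕ) (g : Q → Q → ℝ) :
    ∑ s : Fin (n + 1) → Q, (∏ a : Fin n, M (s a.castSucc) (s a.succ)) * g (s 0) (s (Fin.last n)) =
      ∑ i, ∑ j, (M ^ n) i j * g i j := by
  induction n generalizing g with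
  | zero =>
    rw [← (Equiv.funUnique (Fin 1) Q).symm.sum_comp]
    refine Finset.sum_congr rfl fun i _ => ?_
    simp [Matrix.one_apply]
  | succ n ih =>
    rw [← (Fin.consEquiv fun _ => Q).sum_comp, Fintype.sum_prod_type]
    refine Finset.sum_congr rfl fun i _ => ?_
    have := ih fun i' j => M i i' * g i j
    calc _ = ∑ s : Fin (n + 1) → Q, (∏ a : Fin n, M (s a.castSucc) (s a.succ)) *
          (M i (s 0) * g i (s (Fin.last n))) := by
          refine Finset.sum_congr rfl fun s _ => ?_
          rw [Fin.prod_univ_succ]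
          simp only [Fin.consEquiv_apply, Fin.castSucc_zero, Fin.cons_zero, Fin.cons_succ,
            ← Fin.succ_castSucc, ← Fin.succ_last]
          ring
      _ = _ := by
          rw [this, Finset.sum_comm]
          refine Finset.sum_congr rfl fun j _ => ?_
          rw [pow_succ', Matrix.mul_apply, Finset.sum_mul]
          exact Finset.sum_congr rfl fun i' _ => by ring

/-- Sums over closed walks are traces of matrix powers. -/
theorem sum_cyclic_prod {ℓ : ℕ} [NeZero ℓ] (M : Matrix Q Q ℝ) :
    ∑ s : ZMod ℓ → Q, ∏ a, M (s a) (s (a + 1)) = (M ^ ℓ).trace := by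
  obtain ⟨n, rfl⟩ : ∃ n, ℓ = n + 1 := ⟨ℓ - 1, by have := NeZero.pos ℓ; omega⟩
  -- The end weight closes the walk by the step from the last vertex to the first.
  have h := sum_path_prod M n fun i j => M j i
  have h2 : ∑ s : Fin (n + 1) → Q, ∏ a, M (s a) (s (a + 1)) = (M ^ (n + 1)).trace := by
    rw [Matrix.trace, pow_succ]
    simp_rw [Matrix.diag_apply, Matrix.mul_apply]
    rw [← h]
    refine Finset.sum_congr rfl fun s _ => ?_
    rw [Fin.prod_univ_castSucc]
    simp
  exact h2

/-- The closed-walk sum for the Potts weights. -/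
theorem sum_cyclic_potts {ℓ : ℕ} [NeZero ℓ] [Nonempty Q] (β : ℝ) :
    ∑ s : ZMod ℓ → Q, ∏ a, ((Fintype.card Q : ℝ)⁻¹ * (1 - if s a = s (a + 1) then β else 0)) =
      (1 - β / Fintype.card Q) ^ ℓ + (Fintype.card Q - 1) * (-(β / Fintype.card Q)) ^ ℓ := by
  have hq : (Fintype.card Q : ℝ) ≠ 0 := by exact_mod_cast Fintype.card_ne_zero
  set q : ℝ := (Fintype.card Q : ℝ) with hqdef
  set P : Matrix Q Q ℝ := Matrix.of fun _ _ => q⁻¹ with hP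
  have hPP : P * P = P := by
    ext i j
    simp only [hP, Matrix.mul_apply, Matrix.of_apply, Finset.sum_const, Finset.card_univ,
      nsmul_eq_mul, ← hqdef]
    field_simp
  have hpow : ∀ n : ℕ, ((1 - β / q) • P + (-(β / q)) • (1 - P)) ^ n =
      (1 - β / q) ^ n • P + (-(β / q)) ^ n • (1 - P) := by
    intro n
    induction n with
    | zero => simp
    | succ n ih =>
      have h1 : P * (1 - P) = 0 := by rw [mul_sub, mul_one, hPP, sub_self]
      have h2 : (1 - P) * P = 0 := by rw [sub_mul, one_mul, hPP, sub_self]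
      have h3 : (1 - P) * (1 - P) = 1 - P := by rw [mul_sub, mul_one, h2, sub_zero]
      rw [pow_succ, ih, add_mul, mul_add, mul_add]
      simp only [smul_mul_smul_comm, h1, h2, h3, hPP, smul_zero, add_zero, zero_add, pow_succ]
  -- `P` projects onto the constants, so this is a spectral decomposition: eigenvalue 1 − β/q once
  -- and −β/q on the complement of dimension q − 1.
  have h := sum_cyclic_prod (ℓ := ℓ) ((1 - β / q) • P + (-(β / q)) • (1 - P))
  rw [hpow, Matrix.trace_add, Matrix.trace_smul, Matrix.trace_smul, Matrix.trace_sub,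
    Matrix.trace_one] at h
  have htr : P.trace = 1 := by
    simp only [Matrix.trace, hP, Matrix.diag_apply, Matrix.of_apply, Finset.sum_const,
      Finset.card_univ, nsmul_eq_mul, ← hqdef]
    field_simp
  rw [htr, smul_eq_mul, smul_eq_mul, mul_one, ← hqdef] at h
  rw [mul_comm (q - 1), ← h]
  refine Finset.sum_congr rfl fun s _ => Finset.prod_congr rfl fun a _ => ?_
  simp only [hP, Matrix.add_apply, Matrix.smul_apply, Matrix.sub_apply, Matrix.one_apply,
    Matrix.of_apply, smul_eq_mul]
  split_ifs <;> field_simp <;> ring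

end ClosedWalks

/-! ### Counting non-monochromatic sets -/

section Families

variable {V Q : Type*} [Fintype V] [DecidableEq V] [DecidableEq Q]

/-- The vertices of colour `i`. -/
def colourClass (σ : V → Q) (i : Q) : Finset V := Finset.univ.filter fun v => σ v = i

/-- The `k`-sets that are not monochromatic. -/
def bichromatic (k : ℕ) (σ : V → Q) : Finset (Finset V) :=
  (Finset.powersetCard k Finset.univ).filter fun E => 1 < (E.image σ).card

theorem not_one_lt_card_image_iff {σ : V → Q} {E : Finset V} {u : V} (hu : u ∈ E) :
    ¬ 1 < (E.image σ).card ↔ E ⊆ colourClass σ (σ u) := by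
  rw [not_lt, Finset.card_le_one]
  constructor
  · intro h v hv
    simp only [colourClass, Finset.mem_filter, Finset.mem_univ, true_and]
    exact h _ (Finset.mem_image_of_mem _ hv) _ (Finset.mem_image_of_mem _ hu)
  · intro h a ha b hb
    rw [Finset.mem_image] at ha hb
    obtain ⟨v, hv, rfl⟩ := ha
    obtain ⟨w, hw, rfl⟩ := hb
    have h1 := h hv
    have h2 := h hw
    simp only [colourClass, Finset.mem_filter, Finset.mem_univ, true_and] at h1 h2
    rw [h1, h2]

/-- A nonempty monochromatic set lies in exactly one colour class. -/
theorem card_bichromatic_add [Fintype Q] {k : ℕ} (hk : 1 ≤ k) (σ : V → Q) :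
    (bichromatic k σ).card + ∑ i, (colourClass σ i).card.choose k =
      (Fintype.card V).choose k := by
  rw [← Finset.card_univ, ← Finset.card_powersetCard,
    ← Finset.card_filter_add_card_filter_not (s := Finset.powersetCard k (Finset.univ : Finset V))
      (fun E : Finset V => 1 < (E.image σ).card)]
  congr 1
  have : ((Finset.powersetCard k (Finset.univ : Finset V)).filter
      fun E => ¬ 1 < (E.image σ).card) =
      Finset.univ.biUnion fun i => Finset.powersetCard k (colourClass σ i) := by
    ext E
    simp only [Finset.mem_filter, Finset.mem_powersetCard, Finset.mem_biUnion, Finset.mem_univ,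
      true_and]
    constructor
    · rintro ⟨⟨-, hE⟩, h⟩
      obtain ⟨u, hu⟩ := Finset.card_pos.1 (by omega : 0 < E.card)
      exact ⟨σ u, (not_one_lt_card_image_iff hu).1 h, hE⟩
    · rintro ⟨i, h, hE⟩
      obtain ⟨u, hu⟩ := Finset.card_pos.1 (by omega : 0 < E.card)
      have hi : σ u = i := by simpa [colourClass] using h hu
      subst hi
      exact ⟨⟨Finset.subset_univ _, hE⟩, (not_one_lt_card_image_iff hu).2 h⟩
  rw [this, Finset.card_biUnion]
  · simp
  · intro i _ j _ hij
    rw [Function.onFun, Finset.disjoint_left]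
    intro E h1 h2
    rw [Finset.mem_powersetCard] at h1 h2
    obtain ⟨u, hu⟩ := Finset.card_pos.1 (by omega : 0 < E.card)
    have h3 := h1.1 hu
    have h4 := h2.1 hu
    simp only [colourClass, Finset.mem_filter, Finset.mem_univ, true_and] at h3 h4
    exact hij (h3.symm.trans h4)

theorem codegree_powersetCard {k : ℕ} (hk : 2 ≤ k) {S : Finset V} {u w : V} (huw : u ≠ w)
    (hu : u ∈ S) (hw : w ∈ S) :
    codegree (Finset.powersetCard k S) u w = (S.card - 2).choose (k - 2) := by
  have h2 : ({u, w} : Finset V).card = 2 := Finset.card_pair huw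
  have := Finset.card_filter_powersetCard_subset {u, w} S k
    (by simp [Finset.insert_subset_iff, hu, hw]) (by omega)
  rw [h2] at this
  rw [← this, codegree]
  congr 1
  ext E
  simp [Finset.insert_subset_iff]

/-- A monochromatic set through both vertices exists only if they share a colour, and then it lies
in their class. -/
theorem codegree_bichromatic_add {k : ℕ} (hk : 2 ≤ k) (σ : V → Q) {u w : V} (huw : u ≠ w) :
    codegree (bichromatic k σ) u w +
      (if σ u = σ w then ((colourClass σ (σ u)).card - 2).choose (k - 2) else 0) =
      (Fintype.card V - 2).choose (k - 2) := by
  rw [← Finset.card_univ, ← codegree_powersetCard hk huw (Finset.mem_univ u) (Finset.mem_univ w),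
    codegree, codegree, bichromatic,
    ← Finset.card_filter_add_card_filter_not (s := (Finset.powersetCard k Finset.univ).filter
      fun E => u ∈ E ∧ w ∈ E) (fun E : Finset V => 1 < (E.image σ).card)]
  congr 1
  · rw [Finset.filter_comm]
  · have hiff : ∀ E ∈ (Finset.powersetCard k (Finset.univ : Finset V)).filter
        (fun E => u ∈ E ∧ w ∈ E), (¬ 1 < (E.image σ).card ↔ E ⊆ colourClass σ (σ u)) :=
      fun E hE => not_one_lt_card_image_iff (Finset.mem_filter.1 hE).2.1
    rw [Finset.filter_congr hiff]
    split_ifs with h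
    · rw [← codegree_powersetCard hk huw (by simp [colourClass]) (by simp [colourClass, h]),
        codegree]
      congr 1
      ext E
      simp only [Finset.mem_filter, Finset.mem_powersetCard, Finset.subset_univ, true_and]
      tauto
    · symm
      rw [Finset.card_eq_zero, Finset.filter_eq_empty_iff]
      intro E hE hsub
      have := hsub (Finset.mem_filter.1 hE).2.2
      simp only [colourClass, Finset.mem_filter, Finset.mem_univ, true_and] at this
      exact h this.symm

end Families

/-! ### Sums of codegree products over injective vertex sequences -/

section Codegrees

variable {ι Q : Type*} {l : Filter ι} [Fintype Q] [DecidableEq Q] {N : ι → ℕ}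

/-- Without injectivity the count is a product of class sizes; the non-injective sequences number
N^ℓ − N(N−1)⋯(N−ℓ+1) = o(N^ℓ). -/
theorem tendsto_card_injective_colour {σ : ∀ i, Fin (N i) → Q} {ρ : Q → ℝ}
    (hN : Tendsto N l atTop)
    (hσ : ∀ j, Tendsto (fun i => ((colourClass (σ i) j).card : ℝ) / N i) l (𝓝 (ρ j)))
    {ℓ : ℕ} [NeZero ℓ] (s : ZMod ℓ → Q) :
    Tendsto (fun i => ((Finset.univ.filter fun v : ZMod ℓ → Fin (N i) =>
      Function.Injective v ∧ σ i ∘ v = s).card : ℝ) / (N i : ℝ) ^ ℓ) l (𝓝 (∏ a, ρ (s a))) := by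
  classical
  have hprod : Tendsto (fun i => (∏ a, (colourClass (σ i) (s a)).card : ℝ) / (N i : ℝ) ^ ℓ) l
      (𝓝 (∏ a, ρ (s a))) := by
    refine (tendsto_finsetProd Finset.univ fun a _ => hσ (s a)).congr fun i => ?_
    rw [Finset.prod_div_distrib, Finset.prod_const, Finset.card_univ, ZMod.card]
  have hN0 : ∀ᶠ i in l, (0 : ℝ) < N i :=
    (tendsto_natCast_atTop_atTop.comp hN).eventually_gt_atTop 0
  have hone : Tendsto (fun i => (N i : ℝ) / N i) l (𝓝 1) := by
    refine tendsto_const_nhds.congr' ?_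
    filter_upwards [hN0] with i hi
    rw [div_self hi.ne']
  have hnon : Tendsto (fun i => (∏ a, (colourClass (σ i) (s a)).card : ℝ) / (N i : ℝ) ^ ℓ -
      (((N i : ℝ) / N i) ^ ℓ - ((N i).descFactorial ℓ : ℝ) / (N i : ℝ) ^ ℓ)) l
      (𝓝 (∏ a, ρ (s a))) := by
    simpa using hprod.sub ((hone.pow ℓ).sub (tendsto_descFactorial_div hN hone ℓ))
  have hcard : ∀ i, (Finset.univ.filter fun v : ZMod ℓ → Fin (N i) => σ i ∘ v = s).card =
      ∏ a, (colourClass (σ i) (s a)).card := by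
    intro i
    rw [← Fintype.card_piFinset]
    congr 1
    ext v
    simp [Fintype.mem_piFinset, colourClass, funext_iff]
  refine tendsto_of_tendsto_of_tendsto_of_le_of_le hnon hprod (fun i => ?_) fun i => ?_
  · simp only
    rw [div_pow, ← sub_div, ← sub_div]
    gcongr
    have hinj : (Finset.univ.filter fun v : ZMod ℓ → Fin (N i) => Function.Injective v).card =
        (N i).descFactorial ℓ := by
      have h := Fintype.card_embedding_eq (α := ZMod ℓ) (β := Fin (N i))
      rw [ZMod.card, Fintype.card_fin] at h
      rw [← h, ← Fintype.card_subtype]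
      exact Fintype.card_congr (Equiv.subtypeInjectiveEquivEmbedding _ _)
    have htot := Finset.card_filter_add_card_filter_not
      (s := (Finset.univ : Finset (ZMod ℓ → Fin (N i)))) (fun v => Function.Injective v)
    rw [hinj, Finset.card_univ, Fintype.card_fun, ZMod.card, Fintype.card_fin] at htot
    have hsub : (Finset.univ.filter fun v : ZMod ℓ → Fin (N i) => σ i ∘ v = s) ⊆
        (Finset.univ.filter fun v => Function.Injective v ∧ σ i ∘ v = s) ∪
        (Finset.univ.filter fun v => ¬ Function.Injective v) := by
      intro v hv
      simp only [Finset.mem_union, Finset.mem_filter, Finset.mem_univ, true_and] at hv ⊢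
      tauto
    have hle := (Finset.card_le_card hsub).trans (Finset.card_union_le _ _)
    rw [hcard] at hle
    have hle' : (∏ a, (colourClass (σ i) (s a)).card : ℝ) ≤
        (Finset.univ.filter fun v : ZMod ℓ → Fin (N i) =>
          Function.Injective v ∧ σ i ∘ v = s).card +
        (Finset.univ.filter fun v : ZMod ℓ → Fin (N i) => ¬ Function.Injective v).card := by
      exact_mod_cast hle
    have htot' : ((N i).descFactorial ℓ : ℝ) +
        (Finset.univ.filter fun v : ZMod ℓ → Fin (N i) => ¬ Function.Injective v).card =
        (N i : ℝ) ^ ℓ := by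
      exact_mod_cast htot
    linarith
  · simp only
    gcongr
    rw [← Nat.cast_prod, ← hcard]
    refine Nat.cast_le.2 (Finset.card_le_card fun v hv => ?_)
    simp only [Finset.mem_filter, Finset.mem_univ, true_and] at hv ⊢
    exact hv.2

/-- The product depends only on the colour pattern of the sequence, so the sum is grouped by
patterns, of which there are finitely many. -/
theorem tendsto_sum_injective_prod {σ : ∀ i, Fin (N i) → Q} {ρ : Q → ℝ} {D : ι → Q → Q → ℝ}
    {w : Q → Q → ℝ} {r : ℕ} (hN : Tendsto N l atTop)
    (hσ : ∀ j, Tendsto (fun i => ((colourClass (σ i) j).card : ℝ) / N i) l (𝓝 (ρ j)))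
    (hD : ∀ s t, Tendsto (fun i => D i s t / (N i : ℝ) ^ r) l (𝓝 (w s t)))
    {ℓ : ℕ} [NeZero ℓ] :
    Tendsto (fun i => (∑ v : ZMod ℓ → Fin (N i) with Function.Injective v,
      ∏ a, D i (σ i (v a)) (σ i (v (a + 1)))) / (N i : ℝ) ^ ((r + 1) * ℓ)) l
      (𝓝 (∑ s : ZMod ℓ → Q, ∏ a, (ρ (s a) * w (s a) (s (a + 1))))) := by
  classical
  simp_rw [Finset.prod_mul_distrib]
  refine (tendsto_finsetSum _ fun s _ => (tendsto_card_injective_colour hN hσ s).mul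
    (tendsto_finsetProd _ fun a _ => hD (s a) (s (a + 1)))).congr fun i => ?_
  rw [← Finset.sum_fiberwise (Finset.univ.filter fun v : ZMod ℓ → Fin (N i) =>
    Function.Injective v) (fun v => σ i ∘ v), Finset.sum_div]
  refine Finset.sum_congr rfl fun s _ => ?_
  rw [Finset.filter_filter, Finset.sum_congr rfl (g := fun _ => ∏ a, D i (s a) (s (a + 1)))
    fun v hv => by
      have := (Finset.mem_filter.1 hv).2.2
      subst this
      rfl]
  rw [Finset.sum_const, nsmul_eq_mul, Finset.prod_div_distrib, Finset.prod_const,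
    Finset.card_univ, ZMod.card, div_mul_div_comm, ← pow_mul, ← pow_add]
  congr 2
  ring

end Codegrees

/-! ### Identification of the Poisson means -/

section Rates

/-- With k = r + 2 and p = q^(k-1), the normalised eigenvalues are (p−1)/p and −1/p, while c/φ ·
1/r! equals ck(k−1) p/(p−1). The first eigenvalue yields λ_ℓ, and the others contribute
(q−1)(−1/(p−1))^ℓ = δ_ℓ relative to it. -/
theorem planted_rate {r q ℓ : ℕ} (hq : 2 ≤ q) (hℓ : 1 ≤ ℓ) (c : ℝ) :
    (c / (1 / ((r + 2).factorial : ℝ) - ∑ _i : Fin q, (1 / (q : ℝ)) ^ (r + 2) /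
      ((r + 2).factorial : ℝ))) ^ ℓ *
      ((1 / (r.factorial : ℝ)) ^ ℓ * ((1 - (1 / (q : ℝ)) ^ r / q) ^ ℓ +
        ((q : ℝ) - 1) * (-((1 / (q : ℝ)) ^ r / q)) ^ ℓ)) / (2 * ℓ) =
      lam (r + 2) c ℓ * (1 + del (r + 2) q ℓ) := by
  have hq2 : (2 : ℝ) ≤ q := by exact_mod_cast hq
  have hq0 : (q : ℝ) ≠ 0 := by positivity
  set p : ℝ := (q : ℝ) ^ (r + 1) with hp
  have hp1 : 1 < p := one_lt_pow₀ (by linarith) (by omega)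
  have hp0 : p ≠ 0 := by positivity
  have hpm : p - 1 ≠ 0 := by linarith
  have h1 : (1 / (q : ℝ)) ^ r / q = 1 / p := by
    rw [hp, pow_succ, div_pow, one_pow]
    field_simp
  have hr : (r.factorial : ℝ) ≠ 0 := by exact_mod_cast r.factorial_ne_zero
  have hfac : ((r + 2).factorial : ℝ) = ((r : ℝ) + 2) * (r + 1) * r.factorial := by
    rw [Nat.factorial_succ, Nat.factorial_succ]
    push_cast
    ring
  have hr1 : (r : ℝ) + 1 ≠ 0 := by positivity
  have hr2 : (r : ℝ) + 2 ≠ 0 := by positivity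
  have h2 : (1 / ((r + 2).factorial : ℝ) - ∑ _i : Fin q, (1 / (q : ℝ)) ^ (r + 2) /
      ((r + 2).factorial : ℝ)) = (p - 1) / p / (((r : ℝ) + 2) * (r + 1) * r.factorial) := by
    rw [hfac, Finset.sum_const, Finset.card_univ, Fintype.card_fin, nsmul_eq_mul, hp, div_pow,
      one_pow, pow_succ _ (r + 1)]
    field_simp
  have hl0 : (ℓ : ℝ) ≠ 0 := by
    have : ℓ ≠ 0 := by omega
    exact_mod_cast this
  have h3 : c / ((p - 1) / p / (((r : ℝ) + 2) * (r + 1) * r.factorial)) * (1 / r.factorial) =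
      c * (r + 2) * (r + 1) * (p / (p - 1)) := by
    field_simp
  have h4 : (1 - 1 / p) = (p - 1) / p := by field_simp
  have h5 : -(1 / p) = (-1) / p := by ring
  rw [h1, h2, lam, del, ← mul_assoc, ← mul_pow, h3, h4, h5, mul_pow, div_pow, div_pow, div_pow]
  have h6 : r + 2 - 1 = r + 1 := rfl
  have h7 : (((r + 2 : ℕ) : ℝ) - 1) = r + 1 := by push_cast; ring
  have h8 : (p - 1) ^ ℓ ≠ 0 := pow_ne_zero _ hpm
  rw [h6, ← hp, h7]
  push_cast
  field_simp

theorem uniform_rate {r ℓ : ℕ} (c : ℝ) :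
    (c / (1 / ((r + 2).factorial : ℝ))) ^ ℓ * (1 / (r.factorial : ℝ)) ^ ℓ / (2 * ℓ) =
      lam (r + 2) c ℓ := by
  have hr : (r.factorial : ℝ) ≠ 0 := by exact_mod_cast r.factorial_ne_zero
  have hfac : ((r + 2).factorial : ℝ) = ((r : ℝ) + 2) * (r + 1) * r.factorial := by
    rw [Nat.factorial_succ, Nat.factorial_succ]
    push_cast
    ring
  rw [lam, ← mul_pow, hfac]
  congr 2
  push_cast
  field_simp
  ring

end Rates

/-! ### The uniform and the planted model -/

section Instances

variable {ι : Type*} {l : Filter ι} {k L : ℕ} {N m : ι → ℕ} {c : ℝ}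

theorem tendsto_self_div (hN : Tendsto N l atTop) :
    Tendsto (fun i => (N i : ℝ) / N i) l (𝓝 1) := by
  refine tendsto_const_nhds.congr' ?_
  filter_upwards [hN.eventually_gt_atTop 0] with i hi
  rw [div_self]
  exact_mod_cast hi.ne'

open Classical in
/-- The numbers of loose cycles in the uniform model. -/
theorem tendsto_uniform (hk : 2 ≤ k) (hN : Tendsto N l atTop)
    (hm : Tendsto (fun i => (m i : ℝ) / N i) l (𝓝 c)) (x : ℕ → ℕ) :
    Tendsto (fun i => pr (fun H : Fin (m i) →
        (Finset.powersetCard k Finset.univ : Finset (Finset (Fin (N i)))) =>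
      ∀ ℓ, 2 ≤ ℓ → ℓ ≤ L → (Finset.univ.filter fun A => LooseOn (edges H) ℓ A).card = x ℓ)) l
      (𝓝 (∏ ℓ ∈ Finset.Icc 2 L, poissonProb (lam k c ℓ) (x ℓ))) := by
  obtain ⟨r, rfl⟩ : ∃ r, k = r + 2 := ⟨k - 2, by omega⟩
  have hself := tendsto_self_div hN
  have h := tendsto_pr_looseOn_counts (L := L)
    (𝓕 := fun i => (Finset.powersetCard (r + 2) Finset.univ : Finset (Finset (Fin (N i)))))
    (φ := 1 / ((r + 2).factorial : ℝ)) (τ := fun ℓ => (1 / (r.factorial : ℝ)) ^ ℓ) hk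
    (fun i E hE => (Finset.mem_powersetCard.1 hE).2) hN hm (by positivity) ?_ ?_ x
  · simp_rw [uniform_rate] at h
    exact h
  · simpa using tendsto_choose_div hN hself (r + 2)
  · intro ℓ _ hℓ _
    have : Fact (1 < ℓ) := ⟨by omega⟩
    have hD := tendsto_choose_div hN (tendsto_sub_div hN hself 2) r
    -- The uniform model is treated as having a single colour class of density 1.
    have h := tendsto_sum_injective_prod (Q := Unit) (σ := fun i _ => ()) (ρ := fun _ => 1)
      (D := fun i _ _ => ((N i - 2).choose r : ℝ)) (w := fun _ _ => 1 ^ r / (r.factorial : ℝ))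
      hN (fun j => by simpa [colourClass] using hself) (fun _ _ => hD) (ℓ := ℓ)
    have hlim : (∑ s : ZMod ℓ → Unit, ∏ a : ZMod ℓ, ((1 : ℝ) * (1 ^ r / (r.factorial : ℝ)))) =
        (1 / (r.factorial : ℝ)) ^ ℓ := by
      simp [ZMod.card]
    rw [hlim] at h
    refine h.congr fun i => ?_
    congr 1
    refine Finset.sum_congr rfl fun v hv => Finset.prod_congr rfl fun a _ => ?_
    have hva : v a ≠ v (a + 1) := fun hc => by
      simpa using ((Finset.mem_filter.1 hv).2 hc).symm
    rw [codegree_powersetCard hk hva (Finset.mem_univ _) (Finset.mem_univ _)]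
    simp

open Classical in
/-- The numbers of loose cycles in the planted model. -/
theorem tendsto_planted {q : ℕ} (hk : 2 ≤ k) (hq : 2 ≤ q) (hN : Tendsto N l atTop)
    (hm : Tendsto (fun i => (m i : ℝ) / N i) l (𝓝 c)) {σ : ∀ i, Fin (N i) → Fin q}
    (hσ : ∀ j, Tendsto (fun i => ((colourClass (σ i) j).card : ℝ) / N i) l (𝓝 (1 / q)))
    (x : ℕ → ℕ) :
    Tendsto (fun i => pr (fun H : Fin (m i) → bichromatic k (σ i) =>
      ∀ ℓ, 2 ≤ ℓ → ℓ ≤ L → (Finset.univ.filter fun A => LooseOn (edges H) ℓ A).card = x ℓ)) l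
      (𝓝 (∏ ℓ ∈ Finset.Icc 2 L, poissonProb (lam k c ℓ * (1 + del k q ℓ)) (x ℓ))) := by
  obtain ⟨r, rfl⟩ : ∃ r, k = r + 2 := ⟨k - 2, by omega⟩
  have hself := tendsto_self_div hN
  have : NeZero q := ⟨by omega⟩
  have hq2 : (2 : ℝ) ≤ q := by exact_mod_cast hq
  have h := tendsto_pr_looseOn_counts (L := L) (𝓕 := fun i => bichromatic (r + 2) (σ i))
    (φ := 1 / ((r + 2).factorial : ℝ) - ∑ _i : Fin q, (1 / (q : ℝ)) ^ (r + 2) /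
      ((r + 2).factorial : ℝ))
    (τ := fun ℓ => (1 / (r.factorial : ℝ)) ^ ℓ * ((1 - (1 / (q : ℝ)) ^ r / q) ^ ℓ +
        ((q : ℝ) - 1) * (-((1 / (q : ℝ)) ^ r / q)) ^ ℓ)) hk
    (fun i E hE => (Finset.mem_powersetCard.1 (Finset.mem_filter.1 hE).1).2) hN hm ?_ ?_ ?_ x
  · rw [Finset.prod_congr rfl (g := fun ℓ => poissonProb (lam (r + 2) c ℓ *
      (1 + del (r + 2) q ℓ)) (x ℓ)) fun ℓ hℓ => by
        rw [planted_rate hq (by have := (Finset.mem_Icc.1 hℓ).1; omega)]] at h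
    exact h
  · rw [Finset.sum_const, Finset.card_univ, Fintype.card_fin, nsmul_eq_mul, ← mul_div_assoc,
      ← sub_div]
    have hq1 : (q : ℝ) ≠ 0 := by positivity
    have h1 : (q : ℝ) * (1 / q) ^ (r + 2) = (1 / (q : ℝ)) ^ (r + 1) := by
      rw [pow_succ _ (r + 1)]
      field_simp
    have h2 : (1 / (q : ℝ)) ^ (r + 1) < 1 := by
      refine pow_lt_one₀ (by positivity) ?_ (by omega)
      rw [div_lt_one (by linarith)]
      linarith
    rw [h1]
    exact div_pos (by linarith) (by positivity)
  · have h1 := (tendsto_choose_div hN hself (r + 2)).sub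
      (tendsto_finsetSum Finset.univ fun j _ => tendsto_choose_div hN (hσ j) (r + 2))
    rw [one_pow] at h1
    refine h1.congr fun i => ?_
    have h2 := card_bichromatic_add (k := r + 2) (by omega) (σ i)
    rw [Fintype.card_fin] at h2
    rw [← h2, ← Finset.sum_div, ← sub_div]
    push_cast
    congr 1
    ring
  · intro ℓ _ hℓ _
    have : Fact (1 < ℓ) := ⟨by omega⟩
    have h0 := tendsto_choose_div hN (tendsto_sub_div hN hself 2) r
    -- For distinct vertices the codegree is a function of their colours only.
    have hD : ∀ s t : Fin q, Tendsto (fun i => (((N i - 2).choose r : ℝ) -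
        if s = t then (((colourClass (σ i) s).card - 2).choose r : ℝ) else 0) / (N i : ℝ) ^ r) l
        (𝓝 (1 ^ r / (r.factorial : ℝ) -
          if s = t then (1 / (q : ℝ)) ^ r / (r.factorial : ℝ) else 0)) := by
      intro s t
      simp_rw [sub_div]
      refine h0.sub ?_
      split_ifs
      · exact tendsto_choose_div hN (tendsto_sub_div hN (hσ s) 2) r
      · simpa using tendsto_const_nhds
    have h := tendsto_sum_injective_prod hN hσ hD (ℓ := ℓ)
    have hlim : (∑ s : ZMod ℓ → Fin q, ∏ a : ZMod ℓ, (1 / (q : ℝ) * (1 ^ r / (r.factorial : ℝ) -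
          if s a = s (a + 1) then (1 / (q : ℝ)) ^ r / (r.factorial : ℝ) else 0))) =
        (1 / (r.factorial : ℝ)) ^ ℓ * ((1 - (1 / (q : ℝ)) ^ r / q) ^ ℓ +
        ((q : ℝ) - 1) * (-((1 / (q : ℝ)) ^ r / q)) ^ ℓ) := by
      have hp := sum_cyclic_potts (Q := Fin q) (ℓ := ℓ) ((1 / (q : ℝ)) ^ r)
      rw [Fintype.card_fin] at hp
      rw [← hp, Finset.mul_sum]
      refine Finset.sum_congr rfl fun s _ => ?_
      have hconst : (1 / (r.factorial : ℝ)) ^ ℓ = ∏ _a : ZMod ℓ, (1 / (r.factorial : ℝ)) := by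
        rw [Finset.prod_const, Finset.card_univ, ZMod.card]
      rw [hconst, ← Finset.prod_mul_distrib]
      refine Finset.prod_congr rfl fun a _ => ?_
      split_ifs <;> ring
    rw [hlim] at h
    refine h.congr fun i => ?_
    congr 1
    refine Finset.sum_congr rfl fun v hv => Finset.prod_congr rfl fun a _ => ?_
    have hva : v a ≠ v (a + 1) := fun hc => by
      simpa using ((Finset.mem_filter.1 hv).2 hc).symm
    have hcod := codegree_bichromatic_add hk (σ i) hva
    rw [Fintype.card_fin, Nat.add_sub_cancel] at hcod
    rw [← hcod]
    split_ifs <;> simp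

end Instances

/-! ### Conditioning as a change of edge family -/

section Transfer

variable {n k m : ℕ}

open Classical in
theorem card_multiHypergraph_filter (𝓕 : Finset (Finset (Fin n))) (hk : ∀ E ∈ 𝓕, E.card = k)
    (S : (Fin m → Finset (Fin n)) → Prop) :
    (Finset.univ.filter fun H : MultiHypergraph n k m =>
      (∀ j, (H j).1 ∈ 𝓕) ∧ S fun j => (H j).1).card =
      (Finset.univ.filter fun H : Fin m → 𝓕 => S (edges H)).card := by
  symm
  refine Finset.card_bij (fun H _ j => ⟨(H j).1, hk _ (H j).2⟩) ?_ ?_ ?_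
  · intro H hH
    simp only [Finset.mem_filter, Finset.mem_univ, true_and] at hH ⊢
    exact ⟨fun j => (H j).2, hH⟩
  · intro H _ H' _ h
    funext j
    have := congrFun h j
    simp only [Subtype.mk.injEq] at this
    exact Subtype.ext this
  · intro H hH
    simp only [Finset.mem_filter, Finset.mem_univ, true_and] at hH
    exact ⟨fun j => ⟨(H j).1, hH.1 j⟩, by
      simp only [Finset.mem_filter, Finset.mem_univ, true_and]
      exact hH.2, rfl⟩

open Classical in
theorem condProb_eq_div (S T : MultiHypergraph n k m → Prop) :
    condProb S T = ((Finset.univ.filter fun H => T H ∧ S H).card : ℝ) /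
      (Finset.univ.filter T).card := by
  unfold condProb condMean
  rw [Finset.expect_eq_sum_div_card, Finset.sum_boole, Finset.filter_filter]

/-- The uniform law on a product, conditioned on every coordinate lying in 𝓕, is the uniform law on
the product of copies of 𝓕. -/
theorem condProb_eq_pr (𝓕 : Finset (Finset (Fin n))) (hk : ∀ E ∈ 𝓕, E.card = k)
    (S : (Fin m → Finset (Fin n)) → Prop) :
    condProb (fun H : MultiHypergraph n k m => S fun j => (H j).1) (fun H => ∀ j, (H j).1 ∈ 𝓕) =
      pr (fun H : Fin m → 𝓕 => S (edges H)) := by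
  classical
  have h1 := card_multiHypergraph_filter (m := m) 𝓕 hk S
  have h2 := card_multiHypergraph_filter (m := m) 𝓕 hk (fun _ => True)
  simp only [and_true, Finset.filter_true, Finset.card_univ] at h2
  rw [condProb_eq_div, pr, ← h1, ← h2]
  congr!

open Classical in
theorem cycleEvent_iff {L : ℕ} {x : ℕ → ℕ} (H : MultiHypergraph n k m) :
    CycleEvent L x H ↔ ∀ ℓ, 2 ≤ ℓ → ℓ ≤ L →
      (Finset.univ.filter fun A => LooseOn (fun j => (H j).1) ℓ A).card = x ℓ := by
  unfold CycleEvent cycleCount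
  simp_rw [isLooseCycle_iff]
  rfl

open Classical in
theorem condProb_cycleEvent_eq (𝓕 : Finset (Finset (Fin n))) (hk : ∀ E ∈ 𝓕, E.card = k)
    (L : ℕ) (x : ℕ → ℕ) :
    condProb (fun H : MultiHypergraph n k m => CycleEvent L x H) (fun H => ∀ j, (H j).1 ∈ 𝓕) =
      pr (fun H : Fin m → 𝓕 => ∀ ℓ, 2 ≤ ℓ → ℓ ≤ L →
        (Finset.univ.filter fun A => LooseOn (edges H) ℓ A).card = x ℓ) := by
  rw [← condProb_eq_pr 𝓕 hk fun G => ∀ ℓ, 2 ≤ ℓ → ℓ ≤ L →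
    (Finset.univ.filter fun A => LooseOn G ℓ A).card = x ℓ]
  congr 1
  funext H
  exact propext (cycleEvent_iff H)

theorem isColouring_iff {q : ℕ} (H : MultiHypergraph n k m) (σ : Fin n → Fin q) :
    IsColouring H σ ↔ ∀ j, (H j).1 ∈ bichromatic k σ := by
  unfold IsColouring bichromatic
  refine forall_congr' fun j => ?_
  simp [(H j).2]

end Transfer

/-! ### Uniformity over balanced colourings -/

section Planted

/-- Balance enters through the convergence of the colour densities to 1/q. -/
theorem abs_condProb_sub_lt (k q : ℕ) (hk : 2 ≤ k) (hq : 2 ≤ q) (c : ℝ) (hc : 0 < c) (ω : ℕ → ℝ)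
    (hω : Tendsto ω atTop atTop) (L : ℕ) (x : ℕ → ℕ) (ε : ℝ) (hε : 0 < ε) :
    ∀ᶠ n : ℕ in atTop, ∀ σ : Fin n → Fin q, IsBalanced (ω n) σ →
      |condProb (fun H : MultiHypergraph n k ⌊c * (n : ℝ)⌋₊ => CycleEvent L x H)
          (fun H => IsColouring H σ) -
        ∏ ℓ ∈ Finset.Icc 2 L, poissonProb (lam k c ℓ * (1 + del k q ℓ)) (x ℓ)| < ε := by
  classical
  -- Taking the limit over all pairs (n, σ) along the pullback of n → ∞ makes plain convergence
  -- equivalent to convergence uniform in σ.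
  let ι := Σ n : ℕ, {σ : Fin n → Fin q // IsBalanced (ω n) σ}
  have hN : Tendsto (fun i : ι => i.1) (comap Sigma.fst atTop) atTop := tendsto_comap
  have hm : Tendsto (fun i : ι => (⌊c * (i.1 : ℝ)⌋₊ : ℝ) / i.1) (comap Sigma.fst atTop) (𝓝 c) :=
    ((tendsto_nat_floor_mul_div_atTop hc.le).comp tendsto_natCast_atTop_atTop).comp hN
  have hσ : ∀ j, Tendsto (fun i : ι => ((colourClass i.2.1 j).card : ℝ) / i.1)
      (comap Sigma.fst atTop) (𝓝 (1 / q)) := by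
    intro j
    rw [tendsto_iff_norm_sub_tendsto_zero]
    have hb : Tendsto (fun n : ℕ => 1 / (ω n * Real.sqrt n)) atTop (𝓝 0) :=
      tendsto_const_nhds.div_atTop (hω.atTop_mul_atTop₀
        (Real.tendsto_sqrt_atTop.comp tendsto_natCast_atTop_atTop))
    refine squeeze_zero (fun _ => norm_nonneg _) (fun i => ?_) (hb.comp hN)
    exact i.2.2 j
  have h := tendsto_planted (L := L) hk hq hN hm hσ x
  have h' := (Metric.tendsto_nhds.1 h) ε hε
  rw [eventually_comap] at h'
  filter_upwards [h'] with n hn σ hσb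
  have := hn ⟨n, σ, hσb⟩ rfl
  rw [Real.dist_eq, ← condProb_cycleEvent_eq (bichromatic k σ)
    (fun E hE => (Finset.mem_powersetCard.1 (Finset.mem_filter.1 hE).1).2)] at this
  simp_rw [isColouring_iff]
  exact this

theorem tendsto_pr_cycleEvent (k : ℕ) (hk : 2 ≤ k) (c : ℝ) (hc : 0 < c) (L : ℕ) (x : ℕ → ℕ) :
    Tendsto (fun n : ℕ => pr fun H : MultiHypergraph n k ⌊c * (n : ℝ)⌋₊ => CycleEvent L x H) atTop
      (𝓝 (∏ ℓ ∈ Finset.Icc 2 L, poissonProb (lam k c ℓ) (x ℓ))) := by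
  classical
  have hm : Tendsto (fun n : ℕ => (⌊c * (n : ℝ)⌋₊ : ℝ) / n) atTop (𝓝 c) :=
    (tendsto_nat_floor_mul_div_atTop hc.le).comp tendsto_natCast_atTop_atTop
  refine (tendsto_uniform (L := L) hk tendsto_id hm x).congr fun n => ?_
  have h := condProb_cycleEvent_eq (n := n) (m := ⌊c * (n : ℝ)⌋₊) (Finset.powersetCard k Finset.univ)
    (fun E hE => (Finset.mem_powersetCard.1 hE).2) L x
  simp only [id]
  rw [← h, condProb_eq_div, pr_eq_card]
  have htrue : ∀ (H : MultiHypergraph n k ⌊c * (n : ℝ)⌋₊),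
      (∀ j, (H j).1 ∈ Finset.powersetCard k Finset.univ) = True := fun H =>
    eq_true fun j => Finset.mem_powersetCard.2 ⟨Finset.subset_univ _, (H j).2⟩
  simp only [htrue, true_and, Finset.filter_true, Finset.card_univ]

end Planted

/-! ### The conditional first moment -/

section FirstMoment

variable {n k m q : ℕ}

-- Bayes' rule by double counting the pairs (H, σ) for which H lies in the event and σ is a balanced
-- colouring of H.
open Classical in
theorem condMean_balancedCount (w : ℝ) (E : MultiHypergraph n k m → Prop) :
    condMean (fun H : MultiHypergraph n k m => (balancedCount q w H : ℝ)) E =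
      (∑ σ : Fin n → Fin q with IsBalanced w σ,
        condProb E (fun H => IsColouring H σ) * pr (fun H : MultiHypergraph n k m =>
          IsColouring H σ)) / pr E := by
  by_cases h0 : Fintype.card (MultiHypergraph n k m) = 0
  · have : IsEmpty (MultiHypergraph n k m) := Fintype.card_eq_zero_iff.1 h0
    simp [condMean, pr]
  have h0' : (Fintype.card (MultiHypergraph n k m) : ℝ) ≠ 0 := by exact_mod_cast h0
  have h1 : ∀ σ : Fin n → Fin q, condProb E (fun H : MultiHypergraph n k m => IsColouring H σ) *
      pr (fun H : MultiHypergraph n k m => IsColouring H σ) =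
      ((Finset.univ.filter fun H : MultiHypergraph n k m => IsColouring H σ ∧ E H).card : ℝ) /
        Fintype.card (MultiHypergraph n k m) := by
    intro σ
    rw [condProb_eq_div, pr]
    -- If σ colours no H, the conditional probability is 0 by convention and the joint event is
    -- empty.
    by_cases hz : ((Finset.univ.filter fun H : MultiHypergraph n k m => IsColouring H σ).card : ℝ)
      = 0
    · have : (Finset.univ.filter fun H : MultiHypergraph n k m => IsColouring H σ ∧ E H).card ≤
        (Finset.univ.filter fun H : MultiHypergraph n k m => IsColouring H σ).card :=
        Finset.card_le_card fun H hH => by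
          simp only [Finset.mem_filter, Finset.mem_univ, true_and] at hH ⊢
          exact hH.1
      have hz' : ((Finset.univ.filter fun H : MultiHypergraph n k m =>
          IsColouring H σ ∧ E H).card : ℝ) = 0 := by
        refine le_antisymm ?_ (Nat.cast_nonneg _)
        rw [← hz]
        exact_mod_cast this
      rw [hz, hz']
      simp
    · field_simp
  simp_rw [h1]
  rw [← Finset.sum_div, pr, div_div_div_cancel_right₀ h0', condMean,
    Finset.expect_eq_sum_div_card]
  congr 1
  norm_cast
  unfold balancedCount
  simp_rw [← Finset.filter_filter (fun σ : Fin n → Fin q => IsBalanced w σ)]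
  refine (Finset.sum_card_bipartiteAbove_eq_sum_card_bipartiteBelow
    (fun H σ => IsColouring H σ)).trans (Finset.sum_congr rfl fun σ _ => ?_)
  rw [Finset.bipartiteBelow, Finset.filter_filter]
  congr 1
  ext H
  simp [and_comm]

open Classical in
theorem mean_balancedCount (w : ℝ) :
    mean (fun H : MultiHypergraph n k m => (balancedCount q w H : ℝ)) =
      ∑ σ : Fin n → Fin q with IsBalanced w σ,
        pr (fun H : MultiHypergraph n k m => IsColouring H σ) := by
  have h1 : mean (fun H : MultiHypergraph n k m => (balancedCount q w H : ℝ)) =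
      condMean (fun H : MultiHypergraph n k m => (balancedCount q w H : ℝ)) (fun _ => True) := by
    simp [mean, condMean]
  rw [h1, condMean_balancedCount]
  by_cases h0 : IsEmpty (MultiHypergraph n k m)
  · simp [pr]
  have : Nonempty (MultiHypergraph n k m) := not_isEmpty_iff.1 h0
  rw [pr_true, div_one]
  refine Finset.sum_congr rfl fun σ _ => ?_
  rw [condProb_eq_div, pr_eq_card]
  simp only [and_true]
  by_cases hz : ((Finset.univ.filter fun H : MultiHypergraph n k m => IsColouring H σ).card : ℝ)
    = 0
  · rw [hz]
    simp
  · rw [div_self hz, one_mul]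

theorem poissonProb_pos {μ : ℝ} (hμ : 0 < μ) (x : ℕ) : 0 < poissonProb μ x := by
  unfold poissonProb; positivity

theorem poissonProb_mul_div {μ : ℝ} (hμ : 0 < μ) (δ : ℝ) (x : ℕ) :
    poissonProb (μ * (1 + δ)) x / poissonProb μ x = (1 + δ) ^ x * Real.exp (-(μ * δ)) := by
  rw [div_eq_iff (poissonProb_pos hμ x).ne', poissonProb, poissonProb, mul_pow,
    show -(μ * (1 + δ)) = -(μ * δ) + -μ by ring, Real.exp_add]
  ring

theorem lam_pos {k : ℕ} (hk : 2 ≤ k) {c : ℝ} (hc : 0 < c) {ℓ : ℕ} (hℓ : 1 ≤ ℓ) :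
    0 < lam k c ℓ := by
  have hk' : (2 : ℝ) ≤ k := by exact_mod_cast hk
  have hℓ' : (1 : ℝ) ≤ ℓ := by exact_mod_cast hℓ
  have : (0 : ℝ) < (k : ℝ) - 1 := by linarith
  unfold lam
  positivity

/-- For k ≥ 3 the denominator is at least q² − 1 > q − 1, hence |δ_ℓ| < 1. This keeps the planted
means, and so the planted limit probability, positive. -/
theorem one_add_del_pos {k q : ℕ} (hk : 3 ≤ k) (hq : 2 ≤ q) {ℓ : ℕ} (hℓ : 2 ≤ ℓ) :
    0 < 1 + del k q ℓ := by
  have hq2 : (2 : ℝ) ≤ q := by exact_mod_cast hq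
  have hp : (q : ℝ) ^ 2 ≤ (q : ℝ) ^ (k - 1) := pow_le_pow_right₀ (by linarith) (by omega)
  set p : ℝ := (q : ℝ) ^ (k - 1)
  have h1 : (q : ℝ) - 1 < p - 1 := by nlinarith
  have h2 : (1 : ℝ) ≤ p - 1 := by nlinarith
  have h3 : p - 1 ≤ (p - 1) ^ ℓ := le_self_pow₀ h2 (by omega)
  have h4 : |del k q ℓ| < 1 := by
    unfold del
    rw [abs_div, abs_mul, abs_pow, abs_neg, abs_one, one_pow, one_mul,
      abs_of_nonneg (by linarith : (0 : ℝ) ≤ (q : ℝ) - 1),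
      abs_of_nonneg (by positivity : 0 ≤ (p - 1) ^ ℓ), div_lt_one (by positivity)]
    linarith
  linarith [(abs_lt.1 h4).1]

/-- The quotient is a weighted average of planted probabilities divided by the unconditional one; a
uniform limit passes through any weighted average. -/
theorem tendsto_condMean_div_mean (k q : ℕ) (hk : 3 ≤ k) (hq : 2 ≤ q) (c : ℝ) (hc : 0 < c)
    (ω : ℕ → ℝ) (hω : Tendsto ω atTop atTop) (L : ℕ) (x : ℕ → ℕ) :
    Tendsto (fun n : ℕ =>
      condMean (fun H : MultiHypergraph n k ⌊c * (n : ℝ)⌋₊ => (balancedCount q (ω n) H : ℝ))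
        (CycleEvent L x) /
      mean (fun H : MultiHypergraph n k ⌊c * (n : ℝ)⌋₊ => (balancedCount q (ω n) H : ℝ)))
      (atTop ⊓ 𝓟 {n : ℕ | ∃ σ : Fin n → Fin q, IsBalanced (ω n) σ})
      (𝓝 (∏ ℓ ∈ Finset.Icc 2 L, (1 + del k q ℓ) ^ x ℓ * Real.exp (-(lam k c ℓ * del k q ℓ)))) := by
  classical
  set p := ∏ ℓ ∈ Finset.Icc 2 L, poissonProb (lam k c ℓ * (1 + del k q ℓ)) (x ℓ) with hp
  have hlam : ∀ ℓ ∈ Finset.Icc 2 L, 0 < lam k c ℓ := fun ℓ hℓ =>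
    lam_pos (by omega) hc (by have := (Finset.mem_Icc.1 hℓ).1; omega)
  have hp0 : 0 < p := Finset.prod_pos fun ℓ hℓ => poissonProb_pos
    (mul_pos (hlam ℓ hℓ) (one_add_del_pos hk hq (Finset.mem_Icc.1 hℓ).1)) _
  set p' := ∏ ℓ ∈ Finset.Icc 2 L, poissonProb (lam k c ℓ) (x ℓ)
  have hp'0 : 0 < p' := Finset.prod_pos fun ℓ hℓ => poissonProb_pos (hlam ℓ hℓ) _
  have hE := (tendsto_pr_cycleEvent k (by omega) c hc L x).mono_left
    (inf_le_left (b := 𝓟 {n : ℕ | ∃ σ : Fin n → Fin q, IsBalanced (ω n) σ}))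
  have hplanted := abs_condProb_sub_lt k q (by omega) hq c hc ω hω L x
  let e : ∀ n : ℕ, (Fin n → Fin q) → ℝ := fun n σ =>
    condProb (fun H : MultiHypergraph n k ⌊c * (n : ℝ)⌋₊ => CycleEvent L x H)
      (fun H => IsColouring H σ)
  let a : ∀ n : ℕ, (Fin n → Fin q) → ℝ := fun n σ =>
    pr (fun H : MultiHypergraph n k ⌊c * (n : ℝ)⌋₊ => IsColouring H σ)
  have hA : Tendsto (fun n => (∑ σ : Fin n → Fin q with IsBalanced (ω n) σ, e n σ * a n σ) /
      ∑ σ : Fin n → Fin q with IsBalanced (ω n) σ, a n σ)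
      (atTop ⊓ 𝓟 {n : ℕ | ∃ σ : Fin n → Fin q, IsBalanced (ω n) σ}) (𝓝 p) := by
    rw [Metric.tendsto_nhds]
    intro ε hε
    rw [eventually_inf_principal]
    filter_upwards [hplanted (ε / 2) (half_pos hε), hplanted p hp0] with n h1 h2 ⟨σ₀, hσ₀⟩
    -- If σ coloured no H, its conditional probability would be 0 by convention, at distance exactly
    -- p from p, against the planted limit with tolerance p.
    have ha0 : ∀ σ, IsBalanced (ω n) σ → 0 < a n σ := by
      intro σ hσ
      refine lt_of_le_of_ne (pr_nonneg _) fun hc0 => ?_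
      have h3 := h2 σ hσ
      have h4 : e n σ = 0 := by
        simp only [a, pr_eq_card] at hc0
        simp only [e, condProb_eq_div]
        rcases div_eq_zero_iff.1 hc0.symm with h | h
        · rw [h, div_zero]
        · have : IsEmpty (MultiHypergraph n k ⌊c * (n : ℝ)⌋₊) :=
            Fintype.card_eq_zero_iff.1 (by exact_mod_cast h)
          simp
      simp only [e] at h4
      rw [h4, zero_sub, abs_neg, abs_of_pos hp0] at h3
      exact lt_irrefl _ h3
    have hsum : 0 < ∑ σ : Fin n → Fin q with IsBalanced (ω n) σ, a n σ :=
      Finset.sum_pos (fun σ hσ => ha0 σ (Finset.mem_filter.1 hσ).2) ⟨σ₀, by simpa using hσ₀⟩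
    rw [Real.dist_eq, div_sub' hsum.ne', abs_div, abs_of_pos hsum, div_lt_iff₀ hsum,
      Finset.sum_mul, ← Finset.sum_sub_distrib]
    refine (Finset.abs_sum_le_sum_abs _ _).trans_lt ?_
    rw [Finset.mul_sum]
    refine Finset.sum_lt_sum_of_nonempty ⟨σ₀, by simpa using hσ₀⟩ fun σ hσ => ?_
    have hb := (Finset.mem_filter.1 hσ).2
    rw [mul_comm (a n σ) p, ← sub_mul, abs_mul, abs_of_pos (ha0 σ hb)]
    exact mul_lt_mul_of_pos_right ((h1 σ hb).trans (half_lt_self hε)) (ha0 σ hb)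
  have hlim := hA.div hE hp'0.ne'
  rw [hp, ← Finset.prod_div_distrib, Finset.prod_congr rfl fun ℓ hℓ =>
    poissonProb_mul_div (hlam ℓ hℓ) (del k q ℓ) (x ℓ)] at hlim
  refine hlim.congr fun n => ?_
  rw [condMean_balancedCount, mean_balancedCount]
  exact div_right_comm _ _ _

end FirstMoment

/-! ### Convergence of the series -/

section Series

/-- The signs square away and the terms are (q−1)²/2 · r^ℓ/ℓ: dominated by a geometric series if r <
1, and at least harmonic if r ≥ 1. -/
theorem summable_lam_mul_del_sq_iff {k q : ℕ} (hk : 2 ≤ k) (hq : 2 ≤ q) {c : ℝ} (hc : 0 < c) :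
    Summable (fun i : ℕ => lam k c (i + 2) * del k q (i + 2) ^ 2) ↔
      c * k * ((k : ℝ) - 1) < ((q : ℝ) ^ (k - 1) - 1) ^ 2 := by
  have hq2 : (2 : ℝ) ≤ q := by exact_mod_cast hq
  have hk2 : (2 : ℝ) ≤ k := by exact_mod_cast hk
  have hp : (q : ℝ) ^ 1 ≤ (q : ℝ) ^ (k - 1) := pow_le_pow_right₀ (by linarith) (by omega)
  set p : ℝ := (q : ℝ) ^ (k - 1) with hpdef
  have hp1 : 0 < p - 1 := by linarith
  set r : ℝ := c * k * ((k : ℝ) - 1) / (p - 1) ^ 2 with hr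
  have hr0 : 0 < r := by
    have : (0 : ℝ) < (k : ℝ) - 1 := by linarith
    positivity
  have hterm : ∀ i : ℕ, lam k c (i + 2) * del k q (i + 2) ^ 2 =
      ((q : ℝ) - 1) ^ 2 / 2 * (r ^ (i + 2) / ((i + 2 : ℕ) : ℝ)) := by
    intro i
    have h1 : ((-1 : ℝ) ^ (i + 2)) ^ 2 = 1 := by
      rw [← pow_mul, mul_comm, pow_mul]
      norm_num
    unfold lam del
    rw [hr, ← hpdef, div_pow, div_pow, mul_pow ((-1) ^ (i + 2)), h1, ← pow_mul, ← pow_mul,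
      mul_comm 2 (i + 2)]
    field_simp
  have hq0 : ((q : ℝ) - 1) ^ 2 / 2 ≠ 0 := by
    have : (0 : ℝ) < (q : ℝ) - 1 := by linarith
    positivity
  simp_rw [hterm]
  rw [summable_mul_left_iff hq0, summable_nat_add_iff 2 (f := fun n : ℕ => r ^ n / (n : ℝ))]
  rw [show c * k * ((k : ℝ) - 1) < (p - 1) ^ 2 ↔ r < 1 by rw [hr, div_lt_one (by positivity)]]
  constructor
  · intro h
    by_contra! hcon
    refine Real.not_summable_one_div_natCast (Summable.of_nonneg_of_le (fun n => by positivity)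
      (fun n => ?_) h)
    gcongr
    exact one_le_pow₀ hcon
  · intro h
    refine Summable.of_nonneg_of_le (fun n => by positivity) (fun n => ?_)
      (summable_geometric_of_lt_one hr0.le h)
    rcases Nat.eq_zero_or_pos n with rfl | hn
    · simp
    · exact div_le_self (by positivity) (by exact_mod_cast hn)

/-- From 3 · 4/3 = 2² and log(4/3) ≥ 1/4. -/
theorem log_three_le : Real.log 3 ≤ 7 / 6 := by
  have h1 : Real.log 3 + Real.log (4 / 3) = 2 * Real.log 2 := by
    rw [← Real.log_mul (by norm_num) (by norm_num), show (3 : ℝ) * (4 / 3) = 2 ^ 2 by norm_num,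
      Real.log_pow]
    norm_num
  have h2 := Real.one_sub_inv_le_log_of_pos (by norm_num : (0 : ℝ) < 4 / 3)
  have h3 := Real.log_two_lt_d9
  norm_num at h2
  linarith

/-- Equality holds at k = 3, so 7/6 is the largest constant possible there. -/
theorem mul_pred_le_three_pow {k : ℕ} (hk : 3 ≤ k) :
    (7 / 6 : ℝ) * (k * (k - 1)) + 2 ≤ 3 ^ (k - 1) := by
  induction k, hk using Nat.le_induction with
  | base => norm_num
  | succ k hk ih =>
    obtain ⟨j, rfl⟩ : ∃ j, k = j + 3 := ⟨k - 3, by omega⟩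
    have h1 : (3 : ℝ) ^ (j + 3 + 1 - 1) = 3 * 3 ^ (j + 3 - 1) := by
      rw [← pow_succ']
      rfl
    rw [h1]
    push_cast at ih ⊢
    have : (0 : ℝ) ≤ j := Nat.cast_nonneg j
    nlinarith

/-- With p = q^(k-1) the left side is at most p · k log p, so k log p ≤ p − 2 suffices, as p(p − 2)
< (p − 1)². This is checked at q = 3 and carried to larger q by concavity of the logarithm. -/
theorem density_lt_of_le_log {k q : ℕ} (hk : 3 ≤ k) (hq : 3 ≤ q) {c : ℝ}
    (h : c ≤ (q : ℝ) ^ (k - 1) * Real.log q) :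
    c * k * ((k : ℝ) - 1) < ((q : ℝ) ^ (k - 1) - 1) ^ 2 := by
  have hq3 : (3 : ℝ) ≤ q := by exact_mod_cast hq
  have hk3 : (3 : ℝ) ≤ k := by exact_mod_cast hk
  set p : ℝ := (q : ℝ) ^ (k - 1) with hp
  set b : ℝ := (3 : ℝ) ^ (k - 1) with hb
  have hbp : b ≤ p := pow_le_pow_left₀ (by norm_num) hq3 _
  have hb0 : 0 < b := by positivity
  have hp0 : 0 < p := by positivity
  have hkc : ((k - 1 : ℕ) : ℝ) = (k : ℝ) - 1 := by
    rw [Nat.cast_sub (by omega)]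
    simp
  have hlogp : Real.log p = ((k : ℝ) - 1) * Real.log q := by
    rw [hp, Real.log_pow, hkc]
  have hlogb : Real.log b = ((k : ℝ) - 1) * Real.log 3 := by
    rw [hb, Real.log_pow, hkc]
  have hkb := mul_pred_le_three_pow hk
  rw [← hb] at hkb
  have h1 : c * k * ((k : ℝ) - 1) ≤ k * p * Real.log p := by
    rw [hlogp]
    calc c * k * ((k : ℝ) - 1) = c * (k * ((k : ℝ) - 1)) := by ring
      _ ≤ (p * Real.log q) * (k * ((k : ℝ) - 1)) :=
        mul_le_mul_of_nonneg_right h (mul_nonneg (by linarith) (by linarith))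
      _ = _ := by ring
  -- Tangent to the logarithm at b = 3^(k-1); after multiplication by k its slope k/b is at most 1,
  -- so the bound at b persists for p ≥ b.
  have h2 : Real.log p ≤ Real.log b + (p / b - 1) := by
    have := Real.log_le_sub_one_of_pos (div_pos hp0 hb0)
    rw [Real.log_div hp0.ne' hb0.ne'] at this
    linarith
  have h3 : k * Real.log b ≤ b - 2 := by
    rw [hlogb]
    have h0 : 0 ≤ (k : ℝ) * (k - 1) := mul_nonneg (by linarith) (by linarith)
    have := mul_le_mul_of_nonneg_left log_three_le h0
    linarith
  have hkb' : (k : ℝ) ≤ b := by nlinarith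
  have h4 : k * (p / b - 1) ≤ p - b := by
    rw [div_sub_one hb0.ne', mul_div_assoc', div_le_iff₀ hb0]
    nlinarith
  have h5 : k * Real.log p ≤ p - 2 := by nlinarith
  nlinarith

end Series

end LooseCycles

theorem mainTheorem6 (k q : ℕ) (hk : 3 ≤ k) (hq : 3 ≤ q) (c : ℝ) (hc : 0 < c) :
    -- Impact of the cycle counts on the first moment; the quotient is considered along those `n`
    -- for which a balanced map exists (otherwise it is `0 / 0`).
    (∀ ω : ℕ → ℝ, (∀ n, 0 < ω n) → Tendsto ω atTop atTop →
      ∀ (L : ℕ) (x : ℕ → ℕ),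
        Tendsto
          (fun n : ℕ =>
            LooseCycles.condMean
                (fun H : LooseCycles.MultiHypergraph n k ⌊c * (n : ℝ)⌋₊ =>
                  (LooseCycles.balancedCount q (ω n) H : ℝ))
                (LooseCycles.CycleEvent L x) /
              LooseCycles.mean
                (fun H : LooseCycles.MultiHypergraph n k ⌊c * (n : ℝ)⌋₊ =>
                  (LooseCycles.balancedCount q (ω n) H : ℝ)))
          (atTop ⊓ 𝓟 {n : ℕ | ∃ σ : Fin n → Fin q, LooseCycles.IsBalanced (ω n) σ})
          (𝓝 (∏ ℓ ∈ Finset.Icc 2 L,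
            (1 + LooseCycles.del k q ℓ) ^ x ℓ *
              Real.exp (-(LooseCycles.lam k c ℓ * LooseCycles.del k q ℓ))))) ∧
    -- Given a planted balanced colouring, the cycle counts are asymptotically independent
    -- Poisson variables, uniformly in the colouring.
    (∀ ω : ℕ → ℝ, (∀ n, 0 < ω n) → Tendsto ω atTop atTop →
      ∀ (L : ℕ) (x : ℕ → ℕ) (ε : ℝ), 0 < ε →
        ∀ᶠ n : ℕ in atTop, ∀ σ : Fin n → Fin q, LooseCycles.IsBalanced (ω n) σ →
          |LooseCycles.condProb
              (fun H : LooseCycles.MultiHypergraph n k ⌊c * (n : ℝ)⌋₊ =>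
                LooseCycles.CycleEvent L x H)
              (fun H => LooseCycles.IsColouring H σ) -
            ∏ ℓ ∈ Finset.Icc 2 L,
              LooseCycles.poissonProb
                (LooseCycles.lam k c ℓ * (1 + LooseCycles.del k q ℓ)) (x ℓ)| < ε) ∧
    -- Convergence of the series `∑_{ℓ ≥ 2} λ_ℓ δ_ℓ²`: the exact range of densities,
    (Summable (fun i : ℕ => LooseCycles.lam k c (i + 2) * LooseCycles.del k q (i + 2) ^ 2) ↔
      c * k * ((k : ℝ) - 1) < ((q : ℝ) ^ (k - 1) - 1) ^ 2) ∧
    -- which contains the whole range up to `q^(k-1) ln q`.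
    (c ≤ (q : ℝ) ^ (k - 1) * Real.log q →
      Summable (fun i : ℕ =>
        LooseCycles.lam k c (i + 2) * LooseCycles.del k q (i + 2) ^ 2)) := by
  refine ⟨fun ω _ hω L x => ?_, fun ω _ hω L x ε hε => ?_, ?_, fun h => ?_⟩
  · exact LooseCycles.tendsto_condMean_div_mean k q hk (by omega) c hc ω hω L x
  · exact LooseCycles.abs_condProb_sub_lt k q (by omega) (by omega) c hc ω hω L x ε hε
  · exact LooseCycles.summable_lam_mul_del_sq_iff (by omega) (by omega) hc
  · exact (LooseCycles.summable_lam_mul_del_sq_iff (by omega) (by omega) hc).2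
      (LooseCycles.density_lt_of_le_log hk hq h)
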